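/- **Definitions.** A clause is a finite set of literals. For integers $n\ge\omega>\xi\ge 1$ take Boolean variables $p_{ij}=p_{ji}$ for unordered pairs $i\ne j$ in $[n]$, $q_{ui}$ for $(u,i)\in[\omega]\times[n]$, and $r_{iv}$ for $(i,v)\in[n]\times[\xi]$. $\mathrm{Clique}_{n,\omega}$ consists of the clauses $\{q_{u1},\dots,q_{un}\}$ for $u\in[\omega]$; $\{\neg q_{ui},\neg q_{vi}\}$ for $u\ne v\in[\omega]$, $i\in[n]$; and $\{\neg q_{ui},\neg q_{vj},p_{ij}\}$ for $u\ne v\in[\omega]$, $i\neq j\in[n]$. $\mathrm{Color}_{n,\xi}$ consists of the clauses $\{r_{i1},\dots,r_{i\xi}\}$ for $i\in[n]$; $\{\neg r_{iu},\neg r_{iv}\}$ for $u\ne v\in[\xi]$, $i\in[n]$; and $\{\neg r_{iv},\neg r_{jv},\neg p_{ij}\}$ for $v\in[\xi]$, $i\ne j\in[n]$. A resolution refutation of a set of clauses $\Psi$ is a finite sequence of clauses ending with the empty clause, each of which is in $\Psi$ or follows from two earlier ones by the rule: from $C\cup\{x\}$ and $D\cup\{\neg x\}$ infer $C\cup D$.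 A $\delta$-random resolution refutation distribution of $\Psi$ is a random distribution $(\pi_s,\Delta_s)_s$ such that for every sample $s$, $\Delta_s$ is a set of clauses in the same variables and $\pi_s$ is a resolution refutation of $\Psi\cup\Delta_s$, and such that every fixed truth assignment to all variables satisfies all clauses of $\Delta_s$ with probability at least $1-\delta$. Its number of clauses is the maximum over $s$ of the number of clauses in $\pi_s$. **Theorem.** There is an absolute constant $c>0$ such that the following holds. Let $n\ge\omega>\xi\ge1$ be integers with $\xi^{1/2}\omega\le 8n/\log_2 n$ and let $\delta<1$. Let $(\pi_s,\Delta_s)_s$ be a $\delta$-random resolution refutation distribution of $\mathrm{Clique}_{n,\omega}\cup\mathrm{Color}_{n,\xi}$ with $k$ clauses, and put $d=\max_s|\Delta_s|$. Then: 1. if $d\delta<1$, then $k\ge(1-d\,\delta^{1/2})\,n^{c\,\xi^{1/2}}$; 2. $k\ge\min\bigl(1/(2\delta^{1/2}),\,n^{c\,\xi^{1/2}}\bigr)$, where $1/(2\delta^{1/2})=\infty$ if $\delta=0$. -/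

import Mathlib

open scoped ENNReal

namespace RandRes

/-- A literal over the variables `V`: `(x, true)` is `x` and `(x, false)` is `¬ x`. -/
abbrev Literal (V : Type*) := V × Bool

/-- A clause is a finite set of literals, read as their disjunction. -/
abbrev Clause (V : Type*) := Finset (Literal V)

section Resolution

variable {V : Type*} [DecidableEq V]

/-- The truth assignment `a` satisfies the clause `C`. -/
def Satisfies (a : V → Bool) (C : Clause V) : Prop :=
  ∃ l ∈ C, a l.1 = l.2

/-- The resolution rule: from `C ∪ {x}` and `D ∪ {¬ x}` infer `C ∪ D`. -/
def IsResolvent (A B E : Clause V) : Prop :=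
  ∃ (x : V) (C D : Clause V),
    A = insert (x, true) C ∧ B = insert (x, false) D ∧ E = C ∪ D

/-- `π` is a resolution refutation of `Ψ`: a sequence of clauses, each of them in `Ψ` or inferred
from two earlier ones by the resolution rule, that ends with the empty clause. -/
def IsRefutation (Ψ : Set (Clause V)) (π : List (Clause V)) : Prop :=
  (∀ i : Fin π.length, π.get i ∈ Ψ ∨
    ∃ j k : Fin π.length, j < i ∧ k < i ∧ IsResolvent (π.get j) (π.get k) (π.get i)) ∧
  π.getLast? = some ∅

/-- A `δ`-random resolution refutation distribution `(π_s, Δ_s)_s` of `Ψ`, with samples `s : S`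
(pairs `(π, Δ)` range over a countable set, so that discrete distributions are all there are). -/
structure RandomRefutation (Ψ : Set (Clause V)) (δ : ℝ) (S : Type*) where
  /-- the distribution of the samples -/
  prob : PMF S
  /-- the refutations `π_s` -/
  refutation : S → List (Clause V)
  /-- the auxiliary sets of clauses `Δ_s` -/
  aux : S → Finset (Clause V)
  isRefutation : ∀ s, IsRefutation (Ψ ∪ (aux s : Set (Clause V))) (refutation s)
  /-- every truth assignment satisfies `Δ_s` with probability at least `1 - δ` -/
  satisfied : ∀ a : V → Bool,
    ENNReal.ofReal (1 - δ) ≤ prob.toOuterMeasure {s | ∀ C ∈ aux s, Satisfies a C}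

/-- `k` is the number of clauses of the random refutation: the maximal number of clauses
among all `π_s`. -/
def RandomRefutation.HasNumClauses {Ψ : Set (Clause V)} {δ : ℝ} {S : Type*}
    (R : RandomRefutation Ψ δ S) (k : ℕ) : Prop :=
  IsGreatest (Set.range fun s => (R.refutation s).length) k

/-- `d = max_s |Δ_s|`. -/
def RandomRefutation.HasMaxAux {Ψ : Set (Clause V)} {δ : ℝ} {S : Type*}
    (R : RandomRefutation Ψ δ S) (d : ℕ) : Prop :=
  IsGreatest (Set.range fun s => (R.aux s).card) d

end Resolution

/-- The variables of the clique-coloring clauses: `p` is indexed by the unordered pairs of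
different elements of `[n]`, `q` by `[ω] × [n]` and `r` by `[n] × [ξ]`. -/
inductive Var (n ω ξ : ℕ) : Type where
  | p (e : {e : Sym2 (Fin n) // ¬ e.IsDiag}) : Var n ω ξ
  | q (u : Fin ω) (i : Fin n) : Var n ω ξ
  | r (i : Fin n) (v : Fin ξ) : Var n ω ξ
  deriving DecidableEq

/-- The variable `p_{ij}`, for `i ≠ j`. -/
def Var.edge {n ω ξ : ℕ} (i j : Fin n) (h : i ≠ j) : Var n ω ξ :=
  Var.p ⟨s(i, j), fun hd => h (Sym2.mk_isDiag_iff.mp hd)⟩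

/-- The set of clauses `Clique_{n,ω}`. -/
def cliqueClauses (n ω ξ : ℕ) : Set (Clause (Var n ω ξ)) :=
  {C | (∃ u : Fin ω, C = Finset.univ.image fun i : Fin n => (Var.q u i, true)) ∨
    (∃ (u v : Fin ω) (i : Fin n), u ≠ v ∧ C = {(Var.q u i, false), (Var.q v i, false)}) ∨
    (∃ (u v : Fin ω) (i j : Fin n) (hij : i ≠ j), u ≠ v ∧
      C = {(Var.q u i, false), (Var.q v j, false), (Var.edge i j hij, true)})}

/-- The set of clauses `Color_{n,ξ}`. -/
def colorClauses (n ω ξ : ℕ) : Set (Clause (Var n ω ξ)) :=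
  {C | (∃ i : Fin n, C = Finset.univ.image fun v : Fin ξ => (Var.r i v, true)) ∨
    (∃ (u v : Fin ξ) (i : Fin n), u ≠ v ∧ C = {(Var.r i u, false), (Var.r i v, false)}) ∨
    (∃ (v : Fin ξ) (i j : Fin n) (hij : i ≠ j),
      C = {(Var.r i v, false), (Var.r j v, false), (Var.edge i j hij, false)})}

end RandRes

/-! The proof runs the method of approximations inside a refutation. One player is a random
pseudo-clique: every vertex joins a core with probability `1/K`, and a core vertex is either given
to one member of `[ω]` or left free for one of `B` classes of members. The other player is a
uniformly random coloring. The clique side judges the literals in `p` and `q`; the coloring judges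
those in `r` and the negative ones in `p`.

Each clause receives a closed family `F` of vertex sets of size at most `ℓ`. Up to rare errors, a
core that falsifies the clause contains a member of `F`, and a coloring that falsifies the clause
makes no member of `F` rainbow. Clique axioms get the empty family and color axioms get all small
sets. Resolution on `r` intersects families, on `q` unites them, and on `p_{ij}` adds to the first
family those members of the second that contain `i` and `j` (`exists_approximates_resolvent`).
Closing a family costs `4^{-P}` per added set on the color side (`exists_closedFamily`), and a
closed family has few minimal members of each size, so cores seldom contain a large one
(`pr_coversLarge_le`). The empty clause is falsified by everything. If its family is empty, the
errors exhaust the clique side; if it has a member, that member is rainbow for three quarters of the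
colorings, which must all be errors (`one_le_or_le_of_isRefutation`). Each line adds an error of
only `n^{-Ω(√ξ)}`, so there are many lines.

The core may have fewer than `ω` vertices, so the members of `[ω]` cannot all be placed in it.
Falsification therefore asks only for a partial injective assignment of free vertices, with every
unassigned member keeping more than half of its options. A resolution on `q_{ui}` with `u`
unassigned gives `u` a fresh vertex (`Falsifies.resolve_q`). This needs few members to be assigned,
and a clause that forces many assignments or exclusions is likely to be made true by the
restriction.

For the auxiliary clauses, averaging fixes one sample `s` (`RandomRefutation.exists_le_pr`). If `d ≥
32`, independence of restriction and coloring shows that each clause is rarely falsified on the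
clique side, or belongs to a group that is rarely falsified on the color side (`exists_split`). If
`d < 32`, the clauses are neutralized by removing at most `d` vertices from the game
(`exists_split_of_satisfies`). -/

namespace RandRes

/-! ### Uniform averages and probabilities on finite types -/

section Averages

variable {Ω Ω₂ : Type*} [Fintype Ω] [Fintype Ω₂]

/-- The average of `f` over a finite type. -/
noncomputable def avg (f : Ω → ℝ) : ℝ := (∑ x, f x) / Fintype.card Ω

/-- The probability of `A` for the uniform distribution on a finite type. -/
noncomputable def pr (A : Set Ω) : ℝ := avg (A.indicator 1)

lemma avg_mono {f g : Ω → ℝ} (h : ∀ x, f x ≤ g x) : avg f ≤ avg g :=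
  div_le_div_of_nonneg_right (Finset.sum_le_sum fun x _ => h x) (Nat.cast_nonneg _)

lemma avg_nonneg {f : Ω → ℝ} (h : ∀ x, 0 ≤ f x) : 0 ≤ avg f :=
  div_nonneg (Finset.sum_nonneg fun x _ => h x) (Nat.cast_nonneg _)

lemma avg_const [Nonempty Ω] (c : ℝ) : avg (fun _ : Ω => c) = c := by
  simp [avg]

lemma avg_add (f g : Ω → ℝ) : avg (fun x => f x + g x) = avg f + avg g := by
  simp [avg, Finset.sum_add_distrib, add_div]

lemma avg_const_mul (c : ℝ) (f : Ω → ℝ) : avg (fun x => c * f x) = c * avg f := by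
  simp [avg, ← Finset.mul_sum, mul_div_assoc]

lemma avg_sum {ι : Type*} (s : Finset ι) (f : ι → Ω → ℝ) :
    avg (fun x => ∑ i ∈ s, f i x) = ∑ i ∈ s, avg (f i) := by
  simp only [avg]
  rw [Finset.sum_comm, Finset.sum_div]

lemma avg_le_of_le [Nonempty Ω] {f : Ω → ℝ} {c : ℝ} (h : ∀ x, f x ≤ c) : avg f ≤ c :=
  (avg_mono h).trans_eq (avg_const c)

lemma avg_prod_type (f : Ω × Ω₂ → ℝ) : avg f = avg fun y => avg fun z => f (y, z) := by
  simp only [avg, Fintype.sum_prod_type, Fintype.card_prod, Nat.cast_mul]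
  rw [← Finset.sum_div, div_div, mul_comm]

/-- Coordinates are independent. The tail bounds for restrictions below are Markov's inequality for
a product weight, evaluated by this identity. -/
lemma avg_pi_prod {ι : Type*} [Fintype ι] [DecidableEq ι] (f : ι → Ω → ℝ) :
    avg (fun x : ι → Ω => ∏ i, f i (x i)) = ∏ i, avg (f i) := by
  simp only [avg]
  rw [Finset.prod_div_distrib, Finset.prod_univ_sum, Fintype.piFinset_univ]
  simp

lemma pr_nonneg (A : Set Ω) : 0 ≤ pr A :=
  avg_nonneg fun x => Set.indicator_nonneg (fun _ _ => zero_le_one) x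

lemma pr_le_avg {A : Set Ω} {f : Ω → ℝ} (h0 : ∀ x, 0 ≤ f x) (h1 : ∀ x ∈ A, 1 ≤ f x) :
    pr A ≤ avg f := by
  refine avg_mono fun x => ?_
  by_cases hx : x ∈ A
  · simpa [hx] using h1 x hx
  · simpa [hx] using h0 x

lemma pr_mono {A A' : Set Ω} (h : A ⊆ A') : pr A ≤ pr A' :=
  avg_mono fun x => Set.indicator_le_indicator_of_subset h (fun _ => zero_le_one) x

lemma pr_univ [Nonempty Ω] : pr (Set.univ : Set Ω) = 1 := by
  rw [pr, Set.indicator_univ]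
  exact avg_const 1

lemma pr_le_one [Nonempty Ω] (A : Set Ω) : pr A ≤ 1 :=
  (pr_mono (Set.subset_univ A)).trans_eq pr_univ

lemma pr_empty : pr (∅ : Set Ω) = 0 := by simp [pr, avg]

lemma pr_union_le (A A' : Set Ω) : pr (A ∪ A') ≤ pr A + pr A' := by
  rw [pr, pr, pr, ← avg_add]
  refine avg_mono fun x => ?_
  by_cases h : x ∈ A <;> by_cases h' : x ∈ A' <;> simp [h, h']

lemma pr_biUnion_le {ι : Type*} (s : Finset ι) (A : ι → Set Ω) :
    pr (⋃ i ∈ s, A i) ≤ ∑ i ∈ s, pr (A i) := by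
  simp only [pr]
  rw [← avg_sum]
  refine pr_le_avg (fun x => Finset.sum_nonneg fun i _ => Set.indicator_nonneg (by simp) x) ?_
  intro x hx
  simp only [Set.mem_iUnion] at hx
  obtain ⟨i, hi, hxi⟩ := hx
  refine le_trans (by simp [hxi]) (Finset.single_le_sum (f := fun i => (A i).indicator 1 x)
    (fun j _ => Set.indicator_nonneg (by simp) x) hi)

lemma pr_compl [Nonempty Ω] (A : Set Ω) : pr Aᶜ = 1 - pr A := by
  have : pr A + pr Aᶜ = 1 := by
    rw [pr, pr, ← avg_add, ← avg_const (Ω := Ω) 1]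
    congr 1
    ext x
    by_cases h : x ∈ A <;> simp [h]
  linarith

end Averages

/-! ### A sunflower-type lemma and closed families -/

section Families

variable {V : Type*} [DecidableEq V]

/-- A family with more than `r ^ k` sets of at most `k` elements contains `r + 1` sets whose pairwise
intersections lie in a common proper subset of one of them. -/
lemma exists_subsets_of_card_lt (r : ℕ) (hr : 1 ≤ r) : ∀ (k : ℕ) (𝒮 : Finset (Finset V)),
    (∀ X ∈ 𝒮, X.card ≤ k) → r ^ k < 𝒮.card →
    ∃ (f : Fin (r + 1) → Finset V) (W : Finset V), (∀ i, f i ∈ 𝒮) ∧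
      (∀ i j, i ≠ j → f i ∩ f j ⊆ W) ∧ ∃ i, W ⊂ f i := by
  induction r, hr using Nat.le_induction with
  | base =>
    intro k 𝒮 _ hcard
    rw [one_pow, Finset.one_lt_card] at hcard
    obtain ⟨X, hX, Y, hY, hXY⟩ := hcard
    wlog h : ¬ X ⊆ Y generalizing X Y
    · refine this Y hY X hX hXY.symm fun h' => hXY ?_
      push Not at h
      exact h.antisymm h'
    refine ⟨![X, Y], X ∩ Y, ?_, ?_, 0, ?_⟩
    · intro i; fin_cases i <;> simp [hX, hY]
    · intro i j hij
      fin_cases i <;> fin_cases j <;> simp_all [Finset.inter_comm]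
    · simpa [Finset.ssubset_iff_subset_ne] using h
  | succ r hr ih =>
    intro k 𝒮 hk hcard
    have hne : 𝒮.Nonempty := Finset.card_pos.mp (by omega)
    obtain ⟨W₁, hW₁, hmax⟩ := Finset.exists_max_image 𝒮 Finset.card hne
    -- Members are sorted by their trace `S` on a largest member `W₁`. If every proper trace had at
    -- most `r ^ (k - |S|)` members, the binomial theorem would bound the family by `(r + 1) ^ k`;
    -- the full trace belongs to `W₁` alone, as no member is larger.
    have hex : ∃ S ∈ W₁.powerset, S ≠ W₁ ∧
        r ^ (k - S.card) < (𝒮.filter fun X => X ∩ W₁ = S).card := by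
      by_contra! hcon
      have h1 : 𝒮.card = ∑ S ∈ W₁.powerset, (𝒮.filter fun X => X ∩ W₁ = S).card :=
        Finset.card_eq_sum_card_fiberwise fun X _ => by simp
      have h2 : ∀ S ∈ W₁.powerset,
          (𝒮.filter fun X => X ∩ W₁ = S).card ≤ r ^ (k - S.card) := by
        intro S hS
        by_cases hSW : S = W₁
        · subst hSW
          have : (𝒮.filter fun X => X ∩ S = S) ⊆ {S} := by
            intro X hX
            simp only [Finset.mem_filter, Finset.inter_eq_right] at hX
            simp only [Finset.mem_singleton]
            exact (Finset.eq_of_subset_of_card_le hX.2 (hmax X hX.1)).symm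
          exact (Finset.card_le_card this).trans (by simpa using Nat.one_le_pow _ _ hr)
        · exact hcon S hS hSW
      have h3 : ∑ S ∈ W₁.powerset, r ^ (k - S.card) = r ^ (k - W₁.card) * (r + 1) ^ W₁.card := by
        rw [add_comm r 1, ← Finset.sum_pow_mul_eq_add_pow, Finset.mul_sum]
        refine Finset.sum_congr rfl fun S hS => ?_
        have := Finset.card_le_card (Finset.mem_powerset.mp hS)
        have := hk W₁ hW₁
        rw [one_pow, one_mul, ← pow_add]
        congr 1; omega
      have h4 : r ^ (k - W₁.card) * (r + 1) ^ W₁.card ≤ (r + 1) ^ k := by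
        calc _ ≤ (r + 1) ^ (k - W₁.card) * (r + 1) ^ W₁.card := by gcongr; omega
          _ = _ := by rw [← pow_add, Nat.sub_add_cancel (hk W₁ hW₁)]
      have := Finset.sum_le_sum h2
      omega
    obtain ⟨S, hS, hSW, hlt⟩ := hex
    have hSsub := Finset.mem_powerset.mp hS
    set 𝒮' := (𝒮.filter fun X => X ∩ W₁ = S).image fun X => X \ S
    have hsup : ∀ X ∈ 𝒮.filter (fun X => X ∩ W₁ = S), S ⊆ X := by
      intro X hX
      rw [← (Finset.mem_filter.mp hX).2]
      exact Finset.inter_subset_left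
    have hcard' : 𝒮'.card = (𝒮.filter fun X => X ∩ W₁ = S).card := by
      refine Finset.card_image_of_injOn fun X hX Y hY hXY => ?_
      have h1 := hsup X hX
      have h2 := hsup Y hY
      beta_reduce at hXY
      rw [← Finset.sdiff_union_of_subset h1, ← Finset.sdiff_union_of_subset h2, hXY]
    obtain ⟨f, W, hf, hfW, i₀, hi₀⟩ := ih (k - S.card) 𝒮' (by
      intro X hX
      obtain ⟨Y, hY, rfl⟩ := Finset.mem_image.mp hX
      rw [Finset.card_sdiff_of_subset (hsup Y hY)]
      exact Nat.sub_le_sub_right (hk Y (Finset.mem_filter.mp hY).1) _) (by omega)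
    have hf' : ∀ i, ∃ X ∈ 𝒮, X ∩ W₁ = S ∧ X \ S = f i := by
      intro i
      obtain ⟨X, hX, hXi⟩ := Finset.mem_image.mp (hf i)
      exact ⟨X, (Finset.mem_filter.mp hX).1, (Finset.mem_filter.mp hX).2, hXi⟩
    choose g hg hgW hgf using hf'
    have hgS : ∀ i, S ⊆ g i := fun i => by rw [← hgW i]; exact Finset.inter_subset_left
    -- Every `g i` meets `W₁` exactly in `S`, so `W₁` can be added at the price of enlarging `W` by
    -- `S`.
    refine ⟨Fin.cons W₁ g, W ∪ S, ?_, ?_, i₀.succ, ?_⟩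
    · intro i
      refine Fin.cases hW₁ (fun j => ?_) i
      simpa using hg j
    · intro i j
      refine Fin.cases ?_ (fun i => ?_) i <;> refine Fin.cases ?_ (fun j => ?_) j
      · simp
      · intro _
        simp only [Fin.cons_zero, Fin.cons_succ]
        rw [Finset.inter_comm, hgW]
        exact Finset.subset_union_right
      · intro _
        simp only [Fin.cons_zero, Fin.cons_succ]
        rw [hgW]
        exact Finset.subset_union_right
      · intro hij
        simp only [Fin.cons_succ]
        intro a ha
        rw [Finset.mem_inter] at ha
        by_cases haS : a ∈ S
        · exact Finset.mem_union_right _ haS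
        · refine Finset.mem_union_left _ (hfW i j (by simpa using hij) ?_)
          rw [← hgf, ← hgf]
          simp [ha.1, ha.2, haS]
    · simp only [Fin.cons_succ]
      rw [Finset.ssubset_iff_of_subset]
      · obtain ⟨a, ha, haW⟩ := Finset.exists_of_ssubset hi₀
        rw [← hgf, Finset.mem_sdiff] at ha
        exact ⟨a, ha.1, by simp [haW, ha.2]⟩
      · refine Finset.union_subset ?_ (hgS i₀)
        refine hi₀.1.trans ?_
        rw [← hgf]
        exact Finset.sdiff_subset

/-- A family of members of `𝒰` is closed if it contains every member of `𝒰` that covers all pairwise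
intersections of `P` members of the family. -/
def IsClosedFamily (P : ℕ) (𝒰 F : Finset (Finset V)) : Prop :=
  F ⊆ 𝒰 ∧ ∀ (f : Fin P → Finset V) (W : Finset V), W ∈ 𝒰 → (∀ i, f i ∈ F) →
    (∀ i j, i ≠ j → f i ∩ f j ⊆ W) → W ∈ F

variable {P : ℕ} {𝒰 F G : Finset (Finset V)}

/-- The `P` members in the definition of closure need not be distinct; a constant sequence gives
closure under supersets. -/
lemma IsClosedFamily.mem_of_subset (hF : IsClosedFamily P 𝒰 F) {X W : Finset V}
    (hX : X ∈ F) (hW : W ∈ 𝒰) (h : X ⊆ W) : W ∈ F :=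
  hF.2 (fun _ => X) W hW (fun _ => hX) fun _ _ _ => by simpa using h

lemma isClosedFamily_empty (hP : 1 ≤ P) : IsClosedFamily P 𝒰 ∅ :=
  ⟨by simp, fun f W _ hf _ => absurd (hf ⟨0, hP⟩) (by simp)⟩

lemma isClosedFamily_self : IsClosedFamily P 𝒰 𝒰 :=
  ⟨subset_rfl, fun _ _ hW _ _ => hW⟩

lemma IsClosedFamily.inter (hF : IsClosedFamily P 𝒰 F) (hG : IsClosedFamily P 𝒰 G) :
    IsClosedFamily P 𝒰 (F ∩ G) :=
  ⟨Finset.inter_subset_left.trans hF.1, fun f W hW hf h => Finset.mem_inter.mpr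
    ⟨hF.2 f W hW (fun i => (Finset.mem_inter.mp (hf i)).1) h,
      hG.2 f W hW (fun i => (Finset.mem_inter.mp (hf i)).2) h⟩⟩

lemma isClosedFamily_filter_subset (hP : 2 ≤ P) (Y : Finset V) :
    IsClosedFamily P 𝒰 (𝒰.filter fun X => Y ⊆ X) := by
  refine ⟨Finset.filter_subset _ _, fun f W hW hf h => Finset.mem_filter.mpr ⟨hW, ?_⟩⟩
  refine (Finset.subset_inter ?_ ?_).trans (h ⟨0, by omega⟩ ⟨1, by omega⟩ (by simp))
  · exact (Finset.mem_filter.mp (hf _)).2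
  · exact (Finset.mem_filter.mp (hf _)).2

open Classical in
/-- The minimal members of `F` with `j` elements. -/
noncomputable def minimalMembers (F : Finset (Finset V)) (j : ℕ) : Finset (Finset V) :=
  F.filter fun X => X.card = j ∧ ∀ W ∈ F, ¬ W ⊂ X

lemma mem_minimalMembers {X : Finset V} {j : ℕ} :
    X ∈ minimalMembers F j ↔ X ∈ F ∧ X.card = j ∧ ∀ W ∈ F, ¬ W ⊂ X := by
  simp [minimalMembers]

lemma exists_minimalMember {X : Finset V} (hX : X ∈ F) :
    ∃ W ⊆ X, W ∈ minimalMembers F W.card := by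
  induction X using Finset.strongInduction with
  | H X ih =>
    by_cases h : ∃ W ∈ F, W ⊂ X
    · obtain ⟨W, hW, hWX⟩ := h
      obtain ⟨W', h1, h2⟩ := ih W hWX hW
      exact ⟨W', h1.trans hWX.1, h2⟩
    · push Not at h
      exact ⟨X, subset_rfl, by simpa [minimalMembers, hX] using h⟩

/-- Otherwise there are `P` minimal members whose pairwise intersections lie in a proper subset `W`
of one of them. Closure puts `W` into `F`, against minimality. -/
lemma card_minimalMembers_le (hP : 2 ≤ P) (h𝒰 : ∀ X ∈ 𝒰, ∀ W ⊆ X, W ∈ 𝒰)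
    (hF : IsClosedFamily P 𝒰 F) (j : ℕ) : (minimalMembers F j).card ≤ (P - 1) ^ j := by
  by_contra! hlt
  obtain ⟨f, W, hf, hfW, i, hi⟩ := exists_subsets_of_card_lt (P - 1) (by omega) j
    (minimalMembers F j) (fun X hX => (Finset.mem_filter.mp hX).2.1.le) hlt
  have hmem : ∀ i, f i ∈ F := fun i => (Finset.mem_filter.mp (hf i)).1
  have hPP : P = P - 1 + 1 := by omega
  refine (Finset.mem_filter.mp (hf i)).2.2 W ?_ hi
  exact hF.2 (fun k => f (Fin.cast hPP k)) W (h𝒰 _ (hF.1 (hmem i)) W hi.1)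
    (fun k => hmem _) fun k l hkl => hfW _ _ (by simpa using hkl)

end Families

/-! ### Random colorings and the closure of a family -/

section Colorings

variable {V : Type*} [Fintype V] [DecidableEq V] {ξ : ℕ}

/-- Recoloring `a` maps pairs of a coloring in the event and a color injectively into `A`: the lost
color of `a` can be read off at `b`. -/
lemma pr_inter_eq_le (hξ : 1 ≤ ξ) {A : Set (V → Fin ξ)} {a b : V} (hab : a ≠ b)
    (hA : ∀ r v, r ∈ A → Function.update r a v ∈ A) :
    pr {r | r ∈ A ∧ r a = r b} ≤ (1 / ξ) * pr A := by
  classical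
  have key : ∑ r : V → Fin ξ, ({r | r ∈ A ∧ r a = r b} : Set (V → Fin ξ)).indicator (1 : (V → Fin ξ) → ℝ) r * ξ
      ≤ ∑ r : V → Fin ξ, A.indicator (1 : (V → Fin ξ) → ℝ) r := by
    have h1 : ∀ S : Set (V → Fin ξ), ∑ r, S.indicator (1 : (V → Fin ξ) → ℝ) r
        = ((Finset.univ.filter fun r => r ∈ S).card : ℝ) := by
      intro S
      rw [Finset.card_filter]
      push_cast
      exact Finset.sum_congr rfl fun r _ => by simp [Set.indicator_apply]
    rw [← Finset.sum_mul, h1, h1]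
    rw [show (ξ : ℝ) = ((Finset.univ : Finset (Fin ξ)).card : ℝ) by simp]
    norm_cast
    rw [← Finset.card_product]
    refine Finset.card_le_card_of_injOn (fun x => Function.update x.1 a x.2) ?_ ?_
    · rintro ⟨r, v⟩ hx
      simp only [Finset.coe_product, Set.mem_prod, Finset.mem_coe, Finset.mem_filter,
        Set.mem_ofPred_eq, Finset.mem_univ, true_and, and_true] at hx ⊢
      exact hA r v hx.1
    · rintro ⟨r, v⟩ hx ⟨r', v'⟩ hx' h
      simp only [Finset.coe_product, Set.mem_prod, Finset.mem_coe, Finset.mem_filter,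
        Set.mem_ofPred_eq, Finset.mem_univ, true_and, and_true] at hx hx' h
      have hv : v = v' := by simpa using congrFun h a
      have hr : ∀ c, c ≠ a → r c = r' c := fun c hc => by
        simpa [Function.update_of_ne hc] using congrFun h c
      refine Prod.ext (funext fun c => ?_) hv
      by_cases hc : c = a
      · subst hc; simp only; rw [hx.2, hx'.2, hr b hab.symm]
      · exact hr c hc
  have hξ' : (0 : ℝ) < ξ := by exact_mod_cast hξ
  rw [← Finset.sum_mul] at key
  simp only [pr, avg]
  rw [← mul_div_assoc]
  refine div_le_div_of_nonneg_right ?_ (Nat.cast_nonneg _)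
  rw [one_div, inv_mul_eq_div, le_div_iff₀ hξ']
  exact key

/-- If `W` gets different colors on `A`, and `A` does not depend on the colors of `X \ W`, then `X`
gets different colors on most of `A`. -/
lemma pr_not_injOn_le (hξ : 1 ≤ ξ) {ℓ : ℕ} (hℓ : 4 * (ℓ * (ℓ - 1)) ≤ ξ) {A : Set (V → Fin ξ)}
    {X W : Finset V} (hX : X.card ≤ ℓ) (hAW : ∀ r ∈ A, Set.InjOn r (W : Set V))
    (hA : ∀ r, ∀ a ∈ X \ W, ∀ v, r ∈ A → Function.update r a v ∈ A) :
    pr {r | r ∈ A ∧ ¬ Set.InjOn r (X : Set V)} ≤ (1 / 4) * pr A := by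
  have hsub : {r | r ∈ A ∧ ¬ Set.InjOn r (X : Set V)} ⊆
      ⋃ e ∈ X.offDiag.filter (fun e => e.1 ∉ W), {r | r ∈ A ∧ r e.1 = r e.2} := by
    rintro r ⟨hr, hinj⟩
    simp only [Set.InjOn] at hinj
    push Not at hinj
    obtain ⟨a, ha, b, hb, hab, hne⟩ := hinj
    simp only [Set.mem_iUnion]
    -- A monochromatic pair has an end outside `W`. That end is listed first, since recoloring it
    -- does not leave `A`.
    by_cases haW : a ∈ W
    · have hbW : b ∉ W := fun hbW => hne (hAW r hr haW hbW hab)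
      exact ⟨(b, a), by simp_all [eq_comm], hr, hab.symm⟩
    · exact ⟨(a, b), by simp_all, hr, hab⟩
  have hpos : 0 ≤ (1 / ξ) * pr A := mul_nonneg (by positivity) (pr_nonneg A)
  have hcard : (X.offDiag.filter fun e => e.1 ∉ W).card ≤ ℓ * (ℓ - 1) := by
    refine (Finset.card_filter_le _ _).trans ?_
    rw [Finset.offDiag_card]
    calc X.card * X.card - X.card = X.card * (X.card - 1) := by rw [Nat.mul_sub, mul_one]
      _ ≤ ℓ * (ℓ - 1) := Nat.mul_le_mul hX (by omega)
  have hξ' : (0 : ℝ) < ξ := by exact_mod_cast hξ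
  calc _ ≤ _ := pr_mono hsub
    _ ≤ _ := pr_biUnion_le _ _
    _ ≤ ∑ e ∈ X.offDiag.filter (fun e => e.1 ∉ W), (1 / ξ) * pr A := by
        refine Finset.sum_le_sum fun e he => ?_
        simp only [Finset.mem_filter, Finset.mem_offDiag] at he
        exact pr_inter_eq_le hξ he.1.2.2 fun r v => hA r e.1 (by simp [he.1.1, he.2]) v
    _ = (X.offDiag.filter fun e => e.1 ∉ W).card * ((1 / ξ) * pr A) := by simp
    _ ≤ (ξ / 4) * ((1 / ξ) * pr A) := by
        refine mul_le_mul_of_nonneg_right ?_ hpos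
        rw [le_div_iff₀ (by norm_num)]
        exact_mod_cast (by omega : (X.offDiag.filter fun e => e.1 ∉ W).card * 4 ≤ ξ)
    _ = _ := by field_simp

/-- Outside `W` the petals are disjoint, so the failure of earlier petals says nothing about the
colors of the next one there. Given that `W` is rainbow, each petal fails with conditional
probability at most `1/4`. -/
lemma pr_petals_le (hξ : 1 ≤ ξ) {ℓ : ℕ} (hℓ : 4 * (ℓ * (ℓ - 1)) ≤ ξ) {P : ℕ}
    (f : Fin P → Finset V) (W : Finset V) (hf : ∀ i, (f i).card ≤ ℓ)
    (hfW : ∀ i j, i ≠ j → f i ∩ f j ⊆ W) :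
    pr {r : V → Fin ξ | Set.InjOn r (W : Set V) ∧ ∀ i, ¬ Set.InjOn r (f i : Set V)}
      ≤ (1 / 4) ^ P := by
  have : Nonempty (V → Fin ξ) := ⟨fun _ => ⟨0, hξ⟩⟩
  suffices h : ∀ t ≤ P, pr {r : V → Fin ξ | Set.InjOn r (W : Set V) ∧
      ∀ i : Fin P, i.1 < t → ¬ Set.InjOn r (f i : Set V)} ≤ (1 / 4) ^ t by
    simpa using h P le_rfl
  intro t
  induction t with
  | zero => intro _; simpa using pr_le_one _
  | succ t ih =>
    intro ht
    set A := {r : V → Fin ξ | Set.InjOn r (W : Set V) ∧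
      ∀ i : Fin P, i.1 < t → ¬ Set.InjOn r (f i : Set V)} with hAdef
    have hupd : ∀ (r : V → Fin ξ) (a : V) (v : Fin ξ) (Y : Finset V), a ∉ Y →
        (Set.InjOn (Function.update r a v) (Y : Set V) ↔ Set.InjOn r (Y : Set V)) := by
      intro r a v Y ha
      refine Set.EqOn.injOn_iff fun c hc => Function.update_of_ne ?_ _ _
      rintro rfl
      exact ha hc
    have hstep := pr_not_injOn_le (A := A) (X := f ⟨t, ht⟩) (W := W) hξ hℓ (hf _)
      (fun r hr => hr.1) (by
        intro r a ha v hr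
        rw [Finset.mem_sdiff] at ha
        refine ⟨(hupd r a v W ha.2).mpr hr.1, fun i hi => ?_⟩
        rw [hupd r a v (f i) fun hai => ha.2 (hfW i ⟨t, ht⟩ (by
          rintro rfl; exact lt_irrefl _ hi) (Finset.mem_inter.mpr ⟨hai, ha.1⟩))]
        exact hr.2 i hi)
    rw [pow_succ']
    refine le_trans (pr_mono ?_) (hstep.trans (by have := ih (by omega); gcongr))
    rintro r ⟨h1, h2⟩
    exact ⟨⟨h1, fun i hi => h2 i (by omega)⟩, h2 ⟨t, ht⟩ (by simp)⟩

/-- Every family has a closed superfamily that has, for most colorings, no more colorful members. -/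
lemma exists_closedFamily (hξ : 1 ≤ ξ) {ℓ : ℕ} (hℓ : 4 * (ℓ * (ℓ - 1)) ≤ ξ) {P : ℕ}
    {𝒰 F : Finset (Finset V)} (h𝒰 : ∀ X ∈ 𝒰, X.card ≤ ℓ) (hF : F ⊆ 𝒰) :
    ∃ G, F ⊆ G ∧ IsClosedFamily P 𝒰 G ∧
      ∃ E : Set (V → Fin ξ), pr E ≤ 𝒰.card * (1 / 4) ^ P ∧ ∀ r ∉ E,
        (∀ X ∈ F, ¬ Set.InjOn r (X : Set V)) → ∀ X ∈ G, ¬ Set.InjOn r (X : Set V) := by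
  classical
  let Q : Finset (Finset V) → Prop := fun G => F ⊆ G ∧
      ∃ E : Set (V → Fin ξ), pr E ≤ G.card * (1 / 4) ^ P ∧ ∀ r ∉ E,
        (∀ X ∈ F, ¬ Set.InjOn r (X : Set V)) → ∀ X ∈ G, ¬ Set.InjOn r (X : Set V)
  have hQF : Q F := ⟨subset_rfl, ∅, by rw [pr_empty]; positivity, fun r _ h => h⟩
  obtain ⟨G, hG, hmax⟩ := Finset.exists_max_image (𝒰.powerset.filter Q) Finset.card
    ⟨F, by simp [hF, hQF]⟩
  simp only [Finset.mem_filter, Finset.mem_powerset] at hG hmax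
  obtain ⟨hG𝒰, hFG, E, hE, hEr⟩ := hG
  refine ⟨G, hFG, ⟨hG𝒰, fun f W hW hf hfW => ?_⟩, E, hE.trans ?_, hEr⟩
  · by_contra hWG
    have hlt : (insert W G).card = G.card + 1 := Finset.card_insert_of_notMem hWG
    -- Adding `W` costs only the colorings for which `W` is rainbow and none of the `P` sets is.
    -- Hence a maximal family with error `4^{-P}` per member is closed.
    refine absurd (hmax (insert W G) ⟨Finset.insert_subset hW hG𝒰,
      hFG.trans (Finset.subset_insert _ _), E ∪ {r : V → Fin ξ | Set.InjOn r (W : Set V) ∧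
        ∀ i, ¬ Set.InjOn r (f i : Set V)}, ?_, ?_⟩) (by omega)
    · refine (pr_union_le _ _).trans ?_
      rw [hlt]
      push_cast
      rw [add_mul, one_mul]
      exact add_le_add hE (pr_petals_le hξ hℓ f W (fun i => h𝒰 _ (hG𝒰 (hf i))) hfW)
    · intro r hr hrF
      simp only [Set.mem_union, Set.mem_ofPred_eq, not_or, not_and, not_forall, not_not] at hr
      have hrG := hEr r hr.1 hrF
      intro X hX hinj
      rcases Finset.mem_insert.mp hX with rfl | hX
      · obtain ⟨i, hi⟩ := hr.2 hinj
        exact hrG _ (hf i) hi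
      · exact hrG X hX hinj
  · gcongr

end Colorings

/-! ### Random restrictions on the clique side -/

section Restrictions

variable {n ω ξ K B : ℕ}

/-- The random choices at a vertex: whether it is free, a member of `[ω]` that is mapped to it
if it is not, and the class of those that may be mapped to it if it is. -/
abbrev VertexState (ω B : ℕ) := Bool × Fin ω × Fin B

/-- The sample space of the random restrictions of the variables `p` and `q`. -/
abbrev Sample (n ω K B : ℕ) := (Fin n → Fin K) × (Fin n → VertexState ω B)

/-- The vertex `i` belongs to the random pseudo-clique; the vertices in `Z` never do. -/
def InCore (Z : Finset (Fin n)) (x : Sample n ω K B) (i : Fin n) : Prop :=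
  i ∉ Z ∧ (x.1 i).val = 0

/-- The restriction sets `q_{ui}` to true. -/
def IsOne (Z : Finset (Fin n)) (x : Sample n ω K B) (u : Fin ω) (i : Fin n) : Prop :=
  InCore Z x i ∧ (x.2 i).1 = false ∧ (x.2 i).2.1 = u

/-- The restriction leaves `q_{ui}` unset; the variables `q_{ui}` that are neither set to true
nor unset are set to false. -/
def IsStar (cls : Fin ω → Fin B) (Z : Finset (Fin n)) (x : Sample n ω K B) (u : Fin ω)
    (i : Fin n) : Prop :=
  InCore Z x i ∧ (x.2 i).1 = true ∧ (x.2 i).2.2 = cls u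

/-- The restriction does not make true any literal of `C` that is about the vertex `i`. -/
def Unsettled (cls : Fin ω → Fin B) (Z : Finset (Fin n)) (C : Clause (Var n ω ξ))
    (x : Sample n ω K B) (i : Fin n) : Prop :=
  ∀ u, ((Var.q u i, true) ∈ C → ¬ IsOne Z x u i) ∧
    ((Var.q u i, false) ∈ C → IsOne Z x u i ∨ IsStar cls Z x u i)

open Classical in
/-- The vertices that can be assigned to `u`. -/
noncomputable def starVertices (cls : Fin ω → Fin B) (Z : Finset (Fin n)) (x : Sample n ω K B)
    (u : Fin ω) : Finset (Fin n) :=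
  Finset.univ.filter (IsStar cls Z x u)

open Classical in
/-- The members of `[ω]` that the falsification of `C` keeps away from `i`. -/
noncomputable def excluded (cls : Fin ω → Fin B) (Z : Finset (Fin n)) (C : Clause (Var n ω ξ))
    (x : Sample n ω K B) (i : Fin n) : Finset (Fin ω) :=
  Finset.univ.filter fun u => IsStar cls Z x u i ∧ (Var.q u i, true) ∈ C

open Classical in
/-- The unset vertices that are assigned by the falsification of `C`. -/
noncomputable def pinned (cls : Fin ω → Fin B) (Z : Finset (Fin n)) (C : Clause (Var n ω ξ))
    (x : Sample n ω K B) : Finset (Fin n) :=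
  Finset.univ.filter fun i => ∃ u, IsStar cls Z x u i ∧ (Var.q u i, false) ∈ C

lemma avg_vertexState (f : VertexState ω B → ℝ) :
    avg f = ((avg fun g => avg fun b => f (true, g, b)) +
      avg fun g => avg fun b => f (false, g, b)) / 2 := by
  rw [avg_prod_type]
  simp only [avg_prod_type]
  simp [avg]

lemma avg_sample_prod (f : Fin n → Fin K → VertexState ω B → ℝ) :
    avg (fun x : Sample n ω K B => ∏ i, f i (x.1 i) (x.2 i)) =
      ∏ i, avg fun a => avg fun b => f i a b := by
  rw [avg_prod_type]
  simp only [avg_pi_prod]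
  exact avg_pi_prod fun i a => avg fun b => f i a b

lemma avg_ite_eq {m : ℕ} (c : Fin m) (a : ℝ) : (avg fun b => if b = c then a else 0) = a / m := by
  simp [avg]

lemma pr_sample_le [NeZero K] {A : Set (Sample n ω K B)} {c : ℝ}
    (h : ∀ y, pr {z | (y, z) ∈ A} ≤ c) : pr A ≤ c := by
  rw [pr, avg_prod_type]
  exact avg_le_of_le h

lemma pr_subset_core_le (Z X : Finset (Fin n)) [NeZero ω] [NeZero B] :
    pr {x : Sample n ω K B | ∀ i ∈ X, InCore Z x i} ≤ (1 / K) ^ X.card := by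
  classical
  rcases Nat.eq_zero_or_pos K with rfl | hK
  · rcases X.eq_empty_or_nonempty with rfl | ⟨i, hi⟩
    · rcases isEmpty_or_nonempty (Sample n ω 0 B) with h | h
      · simp [pr, avg]
      · simpa using pr_le_one _
    · have : IsEmpty (Sample n ω 0 B) := ⟨fun x => (x.1 i).elim0⟩
      simp only [pr, avg, Finset.univ_eq_empty, Finset.sum_empty, zero_div]
      positivity
  have : NeZero K := ⟨hK.ne'⟩
  refine (pr_le_avg (f := fun x => ∏ i, if i ∈ X then (if x.1 i = 0 then 1 else 0) else 1)
    ?_ ?_).trans ?_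
  · intro x
    exact Finset.prod_nonneg fun i _ => by split_ifs <;> simp
  · intro x hx
    refine (Finset.prod_eq_one fun i _ => ?_).ge
    by_cases hi : i ∈ X
    · have := (hx i hi).2
      simp [hi, Fin.ext_iff, this]
    · simp [hi]
  · rw [avg_sample_prod fun i a _ => if i ∈ X then (if a = 0 then 1 else 0) else 1]
    simp only [avg_const]
    have : ∀ i, (avg fun a : Fin K => if i ∈ X then (if a = 0 then (1 : ℝ) else 0) else 1) =
        if i ∈ X then 1 / (K : ℝ) else 1 := by
      intro i
      by_cases hi : i ∈ X
      · simp only [hi, if_true]; exact avg_ite_eq 0 1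
      · simp only [hi, if_false]; exact avg_const 1
    rw [Finset.prod_congr rfl fun i _ => this i]
    simp

variable (cls : Fin ω → Fin B) (Z : Finset (Fin n)) (C : Clause (Var n ω ξ))

/-- A class has at most `(ω + B)/B` members, so the factor `B/(2(ω + B))` keeps the exponent at most
`1/2`, where `exp a ≤ 1 + 2a`. The resulting `1 + |E|/ω` is balanced by the `1 - |E|/ω` that a
vertex with a fixed member contributes. -/
lemma avg_exp_card_class_le [NeZero ω] [NeZero B]
    (hcls : ∀ b, ((Finset.univ.filter fun u => cls u = b).card : ℝ) * B ≤ ω + B)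
    (E : Finset (Fin ω)) :
    (avg fun b => Real.exp (B / (2 * (ω + B)) * (E.filter fun u => cls u = b).card)) ≤
      1 + E.card / ω := by
  have hω : (0 : ℝ) < ω := by exact_mod_cast NeZero.pos ω
  have hB : (0 : ℝ) < B := by exact_mod_cast NeZero.pos B
  have hle : ∀ b, Real.exp (B / (2 * (ω + B)) * (E.filter fun u => cls u = b).card) ≤
      1 + B / (ω + B) * (E.filter fun u => cls u = b).card := by
    intro b
    set t : ℝ := ((E.filter fun u => cls u = b).card : ℝ)
    have ht0 : 0 ≤ t := Nat.cast_nonneg _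
    have ht : t * B ≤ ω + B := by
      refine le_trans (mul_le_mul_of_nonneg_right ?_ hB.le) (hcls b)
      exact Nat.cast_le.mpr (Finset.card_le_card
        (Finset.filter_subset_filter _ (Finset.subset_univ E)))
    set a : ℝ := B / (2 * (ω + B)) * t with ha
    have ha0 : 0 ≤ a := by positivity
    have ha1 : a ≤ 1 / 2 := by
      rw [ha, div_mul_eq_mul_div, div_le_iff₀ (by positivity)]
      linarith
    have h1 := abs_le.mp (Real.abs_exp_sub_one_sub_id_le (x := a) (by rw [abs_of_nonneg ha0]; linarith))
    have h2 : B / (ω + B) * t = 2 * a := by rw [ha]; field_simp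
    rw [h2]
    nlinarith [h1.2]
  refine (avg_mono hle).trans ?_
  rw [avg_add, avg_const, avg_const_mul]
  have hsum : (avg fun b : Fin B => ((E.filter fun u => cls u = b).card : ℝ)) = E.card / B := by
    simp only [avg, Fintype.card_fin]
    congr 1
    norm_cast
    exact (Finset.card_eq_sum_card_fiberwise fun u _ => by simp).symm
  rw [hsum]
  have : (B : ℝ) / (ω + B) * (E.card / B) = E.card / (ω + B) := by field_simp
  rw [this]
  gcongr
  linarith

/-- A clause that excludes many assignments of vertices is likely to be made true. -/
lemma pr_unsettled_excluded_le [NeZero ω] [NeZero B] [NeZero K]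
    (hcls : ∀ b, ((Finset.univ.filter fun u => cls u = b).card : ℝ) * B ≤ ω + B) (t : ℕ) :
    pr {x : Sample n ω K B | (∀ i, Unsettled cls Z C x i) ∧
      t ≤ ∑ i, (excluded cls Z C x i).card} ≤ Real.exp (-(B / (2 * (ω + B)) * t)) := by
  classical
  set lam : ℝ := B / (2 * (ω + B)) with hlam
  have hlam0 : 0 ≤ lam := by positivity
  have hω : (0 : ℝ) < ω := by exact_mod_cast NeZero.pos ω
  refine pr_sample_le fun y => ?_
  let E : Fin n → Finset (Fin ω) := fun i => Finset.univ.filter fun u => (Var.q u i, true) ∈ C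
  let core : Fin n → Prop := fun i => i ∉ Z ∧ (y i).val = 0
  -- On unsettled samples the weight is the exponential of the number of excluded members; weight
  -- zero marks a fixed vertex that makes `C` true. The free and the fixed half together average to
  -- at most one.
  let f : Fin n → VertexState ω B → ℝ := fun i s =>
    if core i then
      (if s.1 then Real.exp (lam * ((E i).filter fun u => cls u = s.2.2).card)
        else if s.2.1 ∈ E i then 0 else 1)
    else 1
  have hf0 : ∀ i s, 0 ≤ f i s := by
    intro i s; simp only [f]; split_ifs <;> positivity
  refine (pr_le_avg (f := fun z => Real.exp (-(lam * t)) * ∏ i, f i (z i)) ?_ ?_).trans ?_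
  · exact fun z => mul_nonneg (Real.exp_pos _).le (Finset.prod_nonneg fun i _ => hf0 i _)
  · rintro z ⟨h1, h2⟩
    have hfi : ∀ i, f i (z i) = Real.exp (lam * (excluded cls Z C (y, z) i).card) := by
      intro i
      have hu := h1 i
      simp only [Unsettled, IsOne, IsStar, InCore] at hu
      by_cases hc : core i
      · by_cases hz : (z i).1 = true
        · simp only [f, if_pos hc, hz, if_true]
          congr 4
          ext u
          have hc' : i ∉ Z ∧ (y i).val = 0 := hc
          simp only [E, excluded, IsStar, InCore, Finset.mem_filter, Finset.mem_univ, true_and,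
            hc', hz, and_comm, eq_comm]
          simp
        · have hE : (z i).2.1 ∉ E i := by
            intro hmem
            simp only [E, Finset.mem_filter, Finset.mem_univ, true_and] at hmem
            exact (hu _).1 hmem ⟨hc, by simpa using hz, rfl⟩
          have : excluded cls Z C (y, z) i = ∅ := by
            ext u; simp [excluded, IsStar, hz]
          simp [f, hc, hz, hE, this]
      · have : excluded cls Z C (y, z) i = ∅ := by
          ext u
          have hc' : ¬ (i ∉ Z ∧ (y i).val = 0) := hc
          simp only [excluded, IsStar, InCore, Finset.mem_filter, hc', false_and, and_false,
            Finset.notMem_empty]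
        simp [f, hc, this]
    rw [Finset.prod_congr rfl fun i _ => hfi i, ← Real.exp_sum, ← Real.exp_add,
      ← Finset.mul_sum]
    rw [Real.one_le_exp_iff]
    have : (t : ℝ) ≤ ∑ i, ((excluded cls Z C (y, z) i).card : ℝ) := by exact_mod_cast h2
    nlinarith
  · rw [avg_const_mul, avg_pi_prod]
    refine mul_le_of_le_one_right (Real.exp_pos _).le ?_
    refine Finset.prod_le_one (fun i _ => avg_nonneg (hf0 i)) fun i _ => ?_
    by_cases hc : core i
    · rw [avg_vertexState]
      have h1 := avg_exp_card_class_le cls hcls (E i)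
      have h2 : (avg fun g : Fin ω => if g ∈ E i then (0 : ℝ) else 1) = 1 - (E i).card / ω := by
        simp only [avg, Fintype.card_fin]
        rw [Finset.sum_ite]
        simp only [Finset.sum_const_zero, zero_add, Finset.sum_const, nsmul_eq_mul, mul_one]
        have : (Finset.univ.filter fun g => g ∉ E i).card + (E i).card = ω := by
          have := Finset.card_filter_add_card_filter_not (s := Finset.univ) (fun g => g ∈ E i)
          simp only [Finset.filter_univ_mem, Finset.card_univ, Fintype.card_fin] at this
          omega
        have h3 : ((Finset.univ.filter fun g => g ∉ E i).card : ℝ) = ω - (E i).card := by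
          rw [eq_sub_iff_add_eq]; exact_mod_cast this
        rw [h3, sub_div, div_self hω.ne']
      simp only [f, if_pos hc, if_true, Bool.false_eq_true, if_false, avg_const]
      have h3 : (avg fun g : Fin ω => avg fun _ : Fin B => if g ∈ E i then (0 : ℝ) else 1) =
          1 - (E i).card / ω := by
        rw [← h2]; congr 1; ext g; exact avg_const _
      rw [h3]
      linarith
    · simp only [f, if_neg hc]
      exact (avg_const 1).le

/-- A clause that assigns many vertices is likely to be made true. -/
lemma pr_unsettled_pinned_le [NeZero ω] [NeZero B] [NeZero K] (t : ℕ) :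
    pr {x : Sample n ω K B | (∀ i, Unsettled cls Z C x i) ∧ t ≤ (pinned cls Z C x).card}
      ≤ (1 / B) ^ t := by
  classical
  have hB : (1 : ℝ) ≤ B := by exact_mod_cast NeZero.one_le
  refine pr_sample_le fun y => ?_
  let D : Fin n → Fin ω → Prop := fun i u => (Var.q u i, false) ∈ C
  let core : Fin n → Prop := fun i => i ∉ Z ∧ (y i).val = 0
  -- A free core vertex with a negative literal leaves `C` unsettled only if its class is the right
  -- one. It then weighs `B`, which the probability `1/B` of that class cancels.
  let f : Fin n → VertexState ω B → ℝ := fun i s =>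
    if core i ∧ ∃ u, D i u then
      (if s.1 then (if ∀ u, D i u → s.2.2 = cls u then (B : ℝ) else 0) else 1)
    else 1
  have hf0 : ∀ i s, 0 ≤ f i s := by
    intro i s; simp only [f]; split_ifs <;> simp
  refine (pr_le_avg (f := fun z => (1 / B) ^ t * ∏ i, f i (z i)) ?_ ?_).trans ?_
  · exact fun z => mul_nonneg (by positivity) (Finset.prod_nonneg fun i _ => hf0 i _)
  · rintro z ⟨h1, h2⟩
    have hfi : ∀ i, (if i ∈ pinned cls Z C (y, z) then (B : ℝ) else 1) ≤ f i (z i) := by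
      intro i
      have hu := h1 i
      simp only [Unsettled] at hu
      split_ifs with hi
      · simp only [pinned, Finset.mem_filter, Finset.mem_univ, true_and] at hi
        obtain ⟨u, hstar, hneg⟩ := hi
        have hall : ∀ u, D i u → (z i).2.2 = cls u := by
          intro v hv
          rcases (hu v).2 hv with h | h
          · exact absurd (h.2.1.symm.trans hstar.2.1) (by simp)
          · exact h.2.2
        have hc : core i := hstar.1
        have hz : (z i).1 = true := hstar.2.1
        simp only [f]
        rw [if_pos ⟨hc, u, hneg⟩, if_pos hz, if_pos hall]
      · simp only [f]
        split_ifs with hA hz hall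
        · exact hB
        · exfalso
          push Not at hall
          obtain ⟨u, hD, hne⟩ := hall
          rcases (hu u).2 hD with h | h
          · exact absurd (h.2.1.symm.trans hz) (by simp)
          · exact hne h.2.2
        · exact le_rfl
        · exact le_rfl
    have h3 : ((B : ℝ)) ^ t ≤ ∏ i, f i (z i) := by
      refine le_trans ?_ (Finset.prod_le_prod (fun i _ => ?_) fun i _ => hfi i)
      · rw [Finset.prod_ite, Finset.prod_const, Finset.prod_const_one, mul_one]
        refine pow_le_pow_right₀ hB ?_
        simpa using h2
      · split_ifs <;> linarith
    rw [one_div, inv_pow, inv_mul_eq_div, le_div_iff₀ (by positivity), one_mul]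
    exact h3
  · rw [avg_const_mul, avg_pi_prod]
    refine mul_le_of_le_one_right (by positivity) ?_
    refine Finset.prod_le_one (fun i _ => avg_nonneg (hf0 i)) fun i _ => ?_
    by_cases hc : core i ∧ ∃ u, D i u
    · obtain ⟨u, hu⟩ := hc.2
      rw [avg_vertexState]
      simp only [f, if_pos hc, if_true, Bool.false_eq_true, if_false, avg_const]
      have : (avg fun b : Fin B => if ∀ u, D i u → b = cls u then (B : ℝ) else 0) ≤ 1 := by
        refine (avg_mono (g := fun b => if b = cls u then (B : ℝ) else 0) fun b => ?_).trans_eq ?_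
        · by_cases hb : b = cls u
          · simp only [hb, if_true]; split_ifs <;> linarith
          · rw [if_neg fun h => hb (h u hu), if_neg hb]
        · rw [avg_ite_eq, div_self (by positivity)]
      have h' := avg_le_of_le (Ω := Fin ω) fun _ => this
      linarith
    · simp only [f, if_neg hc]
      exact (avg_const 1).le

/-- Few members of `[ω]` have few vertices that can be assigned to them. -/
lemma pr_card_starVertices_lt [NeZero ω] [NeZero B] [NeZero K] (c : Fin B) (t : ℕ) :
    pr {x : Sample n ω K B | ∃ u, cls u = c ∧ (starVertices cls Z x u).card < t}
      ≤ 2 ^ t * Real.exp (-((n - Z.card : ℝ) / (4 * K * B))) := by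
  classical
  have hK : (0 : ℝ) < K := by exact_mod_cast NeZero.pos K
  have hB : (0 : ℝ) < B := by exact_mod_cast NeZero.pos B
  -- The weight is `1/2` for each vertex available to the class `c`. A vertex outside `Z` is
  -- available with probability `1/(2KB)`, so its factor averages to `1 - 1/(4KB)`.
  let f : Fin n → Fin K → VertexState ω B → ℝ := fun i a s =>
    1 - if i ∉ Z then (if a = 0 then (if s.1 then (if s.2.2 = c then 1 / 2 else 0) else 0) else 0)
      else 0
  have hf : ∀ i a s, f i a s = if i ∉ Z ∧ a = 0 ∧ s.1 = true ∧ s.2.2 = c then 1 / 2 else 1 := by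
    intro i a s
    simp only [f]
    by_cases h1 : i ∈ Z <;> by_cases h2 : a = 0 <;> by_cases h3 : s.1 = true <;>
      by_cases h4 : s.2.2 = c <;> norm_num [h1, h2, h3, h4]
  have hf0 : ∀ i a s, 0 ≤ f i a s := by
    intro i a s; rw [hf]; split_ifs <;> norm_num
  refine (pr_le_avg (f := fun x => 2 ^ t * ∏ i, f i (x.1 i) (x.2 i)) ?_ ?_).trans ?_
  · exact fun z => mul_nonneg (by positivity) (Finset.prod_nonneg fun i _ => hf0 i _ _)
  · rintro x ⟨u, hu, hlt⟩
    have : ∏ i, f i (x.1 i) (x.2 i) = (1 / 2) ^ (starVertices cls Z x u).card := by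
      simp only [hf]
      rw [Finset.prod_ite, Finset.prod_const, Finset.prod_const_one, mul_one]
      congr 2
      ext i
      simp only [starVertices, IsStar, InCore, Finset.mem_filter, Finset.mem_univ, true_and, hu,
        Fin.ext_iff, Fin.val_zero]
      tauto
    rw [this, one_div, inv_pow, ← div_eq_mul_inv, le_div_iff₀ (by positivity), one_mul]
    exact pow_le_pow_right₀ (by norm_num) hlt.le
  · rw [avg_const_mul, avg_sample_prod]
    refine mul_le_mul_of_nonneg_left ?_ (by positivity)
    have hi : ∀ i, (avg fun a => avg fun b => f i a b) =
        1 - if i ∉ Z then 1 / (4 * K * B : ℝ) else 0 := by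
      intro i
      have havg : ∀ (T : Type) [Fintype T] [Nonempty T] (g : T → ℝ),
          (avg fun b => 1 - g b) = 1 - avg g := by
        intro T _ _ g
        have := avg_add (fun _ : T => (1 : ℝ)) (fun b => (-1) * g b)
        rw [avg_const_mul, avg_const] at this
        rw [sub_eq_add_neg, ← neg_one_mul, ← this]
        congr 1; ext b; ring
      simp only [f, havg]
      congr 1
      by_cases hZ : i ∈ Z
      · simp only [hZ, not_true, if_false]
        simp [avg]
      · simp only [hZ, not_false_eq_true, if_true]
        have h1 : ∀ a : Fin K, (avg fun s : VertexState ω B => if a = 0 then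
            (if s.1 = true then (if s.2.2 = c then (1 : ℝ) / 2 else 0) else 0) else 0) =
            if a = 0 then 1 / (4 * B : ℝ) else 0 := by
          intro a
          split_ifs with ha
          · rw [avg_vertexState]
            simp only [if_true, Bool.false_eq_true, if_false, avg_const, avg_ite_eq]
            field_simp; norm_num
          · exact avg_const 0
        simp only [h1, avg_ite_eq]
        field_simp
    rw [Finset.prod_congr rfl fun i _ => hi i]
    refine (Finset.prod_le_prod (fun i _ => ?_) fun i _ =>
      Real.one_sub_le_exp_neg _).trans_eq ?_
    · rw [← hi i]
      exact avg_nonneg fun a => avg_nonneg fun b => hf0 i a b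
    · rw [← Real.exp_sum, Finset.sum_neg_distrib]
      congr 2
      rw [Finset.sum_ite, Finset.sum_const_zero, add_zero, Finset.sum_const, nsmul_eq_mul]
      have : ((Finset.univ.filter fun i => i ∉ Z).card : ℝ) = n - Z.card := by
        rw [eq_sub_iff_add_eq]
        have := Finset.card_filter_add_card_filter_not (s := Finset.univ) (fun g => g ∈ Z)
        simp only [Finset.filter_univ_mem, Finset.card_univ, Fintype.card_fin] at this
        exact_mod_cast (by omega)
      rw [this]
      ring

end Restrictions

/-! ### Falsification by partial assignments of vertices -/

section Game

variable {n ω ξ K B : ℕ} (cls : Fin ω → Fin B) (Z : Finset (Fin n))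

/-- The clause `C` is falsified by the restriction `x` together with the assignment `α` of vertices to
the members of `S`, and no one outside `S` is kept away from half of the vertices it may get. -/
structure Falsifies (C : Clause (Var n ω ξ)) (x : Sample n ω K B) (S : Finset (Fin ω))
    (α : Fin ω → Fin n) : Prop where
  injOn : Set.InjOn α (S : Set (Fin ω))
  star : ∀ u ∈ S, IsStar cls Z x u (α u)
  neg : ∀ u i, (Var.q u i, false) ∈ C → IsOne Z x u i ∨ (u ∈ S ∧ α u = i)
  pos : ∀ u i, (Var.q u i, true) ∈ C → ¬ IsOne Z x u i ∧ (u ∈ S → α u ≠ i)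
  light : ∀ u ∉ S, 2 * ((starVertices cls Z x u).filter fun i => (Var.q u i, true) ∈ C).card
    < (starVertices cls Z x u).card
  edge_pos : ∀ i j h, (Var.edge i j h, true) ∈ C → ¬ (InCore Z x i ∧ InCore Z x j)
  edge_neg : ∀ i j h, (Var.edge i j h, false) ∈ C → InCore Z x i ∧ InCore Z x j

/-- Some assignment of vertices falsifies `C` together with the restriction `x`. -/
def CliqueFalsifies (C : Clause (Var n ω ξ)) (x : Sample n ω K B) : Prop :=
  ∃ S α, Falsifies cls Z C x S α

variable {cls Z} {C C₁ C₂ : Clause (Var n ω ξ)} {x : Sample n ω K B} {S : Finset (Fin ω)}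
  {α : Fin ω → Fin n}

lemma Falsifies.of_subset (hC : Falsifies cls Z C x S α)
    (hq : ∀ u i b, (Var.q u i, b) ∈ C₁ → (Var.q u i, b) ∈ C)
    (hp : ∀ i j h b, (Var.edge i j h, b) ∈ C₁ → (Var.edge i j h, b) ∈ C) :
    Falsifies cls Z C₁ x S α where
  injOn := hC.injOn
  star := hC.star
  neg u i h := hC.neg u i (hq _ _ _ h)
  pos u i h := hC.pos u i (hq _ _ _ h)
  light u hu := by
    refine lt_of_le_of_lt ?_ (hC.light u hu)
    exact Nat.mul_le_mul_left 2 (Finset.card_le_card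
      (Finset.monotone_filter_right _ fun i _ => hq _ _ _))
  edge_pos i j h hm := hC.edge_pos i j h (hp _ _ _ _ hm)
  edge_neg i j h hm := hC.edge_neg i j h (hp _ _ _ _ hm)

lemma Falsifies.unsettled (hC : Falsifies cls Z C x S α) (i : Fin n) : Unsettled cls Z C x i := by
  refine fun u => ⟨fun h => (hC.pos u i h).1, fun h => ?_⟩
  rcases hC.neg u i h with h | ⟨hu, rfl⟩
  · exact Or.inl h
  · exact Or.inr (hC.star u hu)

/-- The assignment can be limited to few members of `[ω]`. -/
lemma Falsifies.exists_small (hC : Falsifies cls Z C x S α) {D : ℕ}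
    (hstar : ∀ u, 8 * D ≤ (starVertices cls Z x u).card) (hpin : (pinned cls Z C x).card < D)
    (hexc : ∑ i, (excluded cls Z C x i).card < 4 * D ^ 2) :
    ∃ S', Falsifies cls Z C x S' α ∧ S'.card < 2 * D := by
  classical
  -- Only two kinds of members must keep their vertex: those with at least half of their options
  -- excluded, counted through `excluded`, and those whose vertex falsifies a negative literal,
  -- counted through `pinned`.
  set T₁ := S.filter fun u => (starVertices cls Z x u).card ≤
    2 * ((starVertices cls Z x u).filter fun i => (Var.q u i, true) ∈ C).card with hT₁
  set T₂ := S.filter fun u => (Var.q u (α u), false) ∈ C with hT₂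
  have hsub : T₁ ∪ T₂ ⊆ S := Finset.union_subset (Finset.filter_subset _ _) (Finset.filter_subset _ _)
  refine ⟨T₁ ∪ T₂, ⟨hC.injOn.mono (Finset.coe_subset.mpr hsub), fun u hu => hC.star u (hsub hu),
    fun u i h => ?_, fun u i h => ⟨(hC.pos u i h).1, fun hu => (hC.pos u i h).2 (hsub hu)⟩,
    fun u hu => ?_, hC.edge_pos, hC.edge_neg⟩, ?_⟩
  · rcases hC.neg u i h with h' | ⟨hu, rfl⟩
    · exact Or.inl h'
    · exact Or.inr ⟨Finset.mem_union_right _ (by simp [hT₂, hu, h]), rfl⟩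
  · by_cases huS : u ∈ S
    · by_contra hle
      push Not at hle
      exact hu (Finset.mem_union_left _ (by simp [hT₁, huS, hle]))
    · exact hC.light u huS
  · have h2 : T₂.card ≤ (pinned cls Z C x).card := by
      refine Finset.card_le_card_of_injOn α (fun u hu => ?_)
        (hC.injOn.mono (Finset.coe_subset.mpr (Finset.filter_subset _ _)))
      obtain ⟨h1, h2⟩ := Finset.mem_filter.mp hu
      simp only [pinned, Finset.coe_filter, Finset.mem_univ, true_and]
      exact ⟨u, hC.star u h1, h2⟩
    have h1 : T₁.card * (8 * D) ≤ 2 * ∑ i, (excluded cls Z C x i).card := by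
      have hswap : ∑ i, (excluded cls Z C x i).card =
          ∑ u, ((starVertices cls Z x u).filter fun i => (Var.q u i, true) ∈ C).card := by
        simp only [excluded, starVertices, Finset.filter_filter, Finset.card_filter]
        exact Finset.sum_comm
      rw [hswap, Finset.mul_sum, ← smul_eq_mul]
      refine (Finset.card_nsmul_le_sum T₁ _ _ fun u hu => ?_).trans
        (Finset.sum_le_sum_of_subset (Finset.subset_univ T₁))
      exact (hstar u).trans (Finset.mem_filter.mp hu).2
    have h3 : T₁.card < D := by
      by_contra! hle
      have := Nat.mul_le_mul_right (8 * D) hle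
      nlinarith
    have := Finset.card_union_le T₁ T₂
    omega

/-- If `q_{ui}` is open because `u` has no vertex, `u` is given one: fewer than half of its at least
`8D` options are excluded and fewer than `2D` vertices are in use. Whether the new vertex is `i`
selects the premise. -/
lemma Falsifies.resolve_q {C' D' : Clause (Var n ω ξ)} {u : Fin ω} {i : Fin n}
    (hC : Falsifies cls Z (C' ∪ D') x S α) {D : ℕ}
    (hstar : 8 * D ≤ (starVertices cls Z x u).card) (hS : S.card < 2 * D) :
    CliqueFalsifies cls Z (insert (Var.q u i, true) C') x ∨
      CliqueFalsifies cls Z (insert (Var.q u i, false) D') x := by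
  classical
  obtain ⟨hC', hD'⟩ : Falsifies cls Z C' x S α ∧ Falsifies cls Z D' x S α :=
    ⟨hC.of_subset (fun _ _ _ => Finset.mem_union_left _) fun _ _ _ _ => Finset.mem_union_left _,
      hC.of_subset (fun _ _ _ => Finset.mem_union_right _) fun _ _ _ _ => Finset.mem_union_right _⟩
  have hneg : ∀ S α, Falsifies cls Z D' x S α → (IsOne Z x u i ∨ (u ∈ S ∧ α u = i)) →
      Falsifies cls Z (insert (Var.q u i, false) D') x S α := by
    intro S α hF h
    refine ⟨hF.injOn, hF.star, fun v j hm => ?_, fun v j hm => hF.pos v j (by simpa using hm),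
      fun v hv => ?_, fun a b hab hm => hF.edge_pos a b hab (by simpa using hm),
      fun a b hab hm => hF.edge_neg a b hab (by simpa [Var.edge] using hm)⟩
    · rcases Finset.mem_insert.mp hm with hm | hm
      · simp only [Prod.mk.injEq, Var.q.injEq, and_true] at hm
        obtain ⟨rfl, rfl⟩ := hm
        exact h
      · exact hF.neg v j hm
    · simpa using hF.light v hv
  have hpos : ∀ S α, Falsifies cls Z C' x S α → ¬ IsOne Z x u i → (u ∈ S → α u ≠ i) →
      (u ∈ S ∨ ¬ IsStar cls Z x u i) →
      Falsifies cls Z (insert (Var.q u i, true) C') x S α := by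
    intro S α hF h1 h2 h3
    refine ⟨hF.injOn, hF.star, fun v j hm => hF.neg v j (by simpa using hm), fun v j hm => ?_,
      fun v hv => ?_, fun a b hab hm => hF.edge_pos a b hab (by simpa [Var.edge] using hm),
      fun a b hab hm => hF.edge_neg a b hab (by simpa using hm)⟩
    · rcases Finset.mem_insert.mp hm with hm | hm
      · simp only [Prod.mk.injEq, Var.q.injEq, and_true] at hm
        obtain ⟨rfl, rfl⟩ := hm
        exact ⟨h1, h2⟩
      · exact hF.pos v j hm
    · refine lt_of_le_of_lt ?_ (hF.light v hv)
      refine Nat.mul_le_mul_left 2 (Finset.card_le_card fun j hj => ?_)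
      simp only [Finset.mem_filter, Finset.mem_insert, Prod.mk.injEq, Var.q.injEq, and_true]
        at hj ⊢
      refine ⟨hj.1, hj.2.resolve_left ?_⟩
      rintro ⟨rfl, rfl⟩
      rcases h3 with h3 | h3
      · exact hv h3
      · exact h3 (by simpa [starVertices] using hj.1)
  by_cases h1 : IsOne Z x u i
  · exact Or.inr ⟨S, α, hneg S α hD' (Or.inl h1)⟩
  by_cases hu : u ∈ S
  · by_cases hi : α u = i
    · exact Or.inr ⟨S, α, hneg S α hD' (Or.inr ⟨hu, hi⟩)⟩
    · exact Or.inl ⟨S, α, hpos S α hC' h1 (fun _ => hi) (Or.inl hu)⟩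
  obtain ⟨j, hj, hjE⟩ : ∃ j ∈ starVertices cls Z x u,
      j ∉ ((starVertices cls Z x u).filter fun i => (Var.q u i, true) ∈ C' ∪ D') ∪ S.image α := by
    by_contra! hcon
    have h1 := Finset.card_le_card hcon
    have h2 := hC.light u hu
    have h3 := Finset.card_union_le
      ((starVertices cls Z x u).filter fun i => (Var.q u i, true) ∈ C' ∪ D') (S.image α)
    have h4 := Finset.card_image_le (s := S) (f := α)
    omega
  simp only [Finset.mem_union, Finset.mem_filter, Finset.mem_image, not_or, not_and, not_exists,
    hj, true_imp_iff] at hjE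
  obtain ⟨⟨hjC, hjD⟩, hjα⟩ := hjE
  have hne : ∀ v ∈ S, v ≠ u := fun v hv h => hu (h ▸ hv)
  have hext : ∀ E : Clause (Var n ω ξ), (Var.q u j, true) ∉ E → Falsifies cls Z E x S α →
      Falsifies cls Z E x (insert u S) (Function.update α u j) := by
    intro E hjE hF
    have hjS : IsStar cls Z x u j := by simpa [starVertices] using hj
    refine ⟨?_, fun v hv => ?_, fun v k hm => ?_, fun v k hm => ⟨(hF.pos v k hm).1, fun hv => ?_⟩,
      fun v hv => hF.light v fun h => hv (Finset.mem_insert_of_mem h), hF.edge_pos, hF.edge_neg⟩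
    · rw [Finset.coe_insert, Set.injOn_insert (by simpa using hu)]
      refine ⟨?_, ?_⟩
      · intro v hv w hw hvw
        rw [Function.update_of_ne (hne v hv), Function.update_of_ne (hne w hw)] at hvw
        exact hF.injOn hv hw hvw
      · rintro ⟨v, hv, hvj⟩
        rw [Function.update_of_ne (hne v hv), Function.update_self] at hvj
        exact hjα v hv hvj
    · rcases Finset.mem_insert.mp hv with rfl | hv
      · rwa [Function.update_self]
      · rw [Function.update_of_ne (hne v hv)]; exact hF.star v hv
    · rcases hF.neg v k hm with h | ⟨hv, rfl⟩
      · exact Or.inl h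
      · exact Or.inr ⟨Finset.mem_insert_of_mem hv, Function.update_of_ne (hne v hv) _ _⟩
    · rcases Finset.mem_insert.mp hv with rfl | hv
      · rw [Function.update_self]
        rintro rfl
        exact hjE hm
      · rw [Function.update_of_ne (hne v hv)]; exact (hF.pos v k hm).2 hv
  by_cases hij : j = i
  · subst hij
    exact Or.inr ⟨_, _, hneg _ _ (hext D' hjD hD')
      (Or.inr ⟨Finset.mem_insert_self _ _, Function.update_self _ _ _⟩)⟩
  · exact Or.inl ⟨_, _, hpos _ _ (hext C' hjC hC') h1
      (fun _ => by rwa [Function.update_self]) (Or.inl (Finset.mem_insert_self _ _))⟩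

lemma Falsifies.eq_of_neg_mem (hF : Falsifies cls Z C x S α) {u v : Fin ω} {i : Fin n}
    (hu : (Var.q u i, false) ∈ C) (hv : (Var.q v i, false) ∈ C) : u = v := by
  rcases hF.neg u i hu with h1 | ⟨h1, hui⟩ <;> rcases hF.neg v i hv with h2 | ⟨h2, hvi⟩
  · exact h1.2.2.symm.trans h2.2.2
  · have := hF.star v h2
    rw [hvi] at this
    exact absurd (h1.2.1.symm.trans this.2.1) (by simp)
  · have := hF.star u h1
    rw [hui] at this
    exact absurd (h2.2.1.symm.trans this.2.1) (by simp)
  · exact hF.injOn h1 h2 (hui.trans hvi.symm)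

/-- The condition `light` exists for the first kind of axiom: if `u` is unassigned, falsifying all
`q_{ui}` would exclude all of its options. -/
lemma not_cliqueFalsifies_of_mem (hC : C ∈ cliqueClauses n ω ξ) :
    ¬ CliqueFalsifies cls Z C x := by
  rintro ⟨S, α, hF⟩
  rcases hC with ⟨u, rfl⟩ | ⟨u, v, i, huv, rfl⟩ | ⟨u, v, i, j, hij, huv, rfl⟩
  · by_cases hu : u ∈ S
    · exact (hF.pos u (α u) (by simp)).2 hu rfl
    · have := hF.light u hu
      have h1 : ((starVertices cls Z x u).filter fun i => (Var.q u i, true) ∈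
          (Finset.univ.image fun i : Fin n => ((Var.q u i, true) : Literal (Var n ω ξ)))) =
          starVertices cls Z x u := by
        rw [Finset.filter_true_of_mem]; simp
      rw [h1] at this
      omega
  · exact huv (hF.eq_of_neg_mem (i := i) (by simp) (by simp))
  · have hin : ∀ w k, IsOne Z x w k ∨ (w ∈ S ∧ α w = k) → InCore Z x k := by
      rintro w k (h | ⟨hw, rfl⟩)
      · exact h.1
      · exact (hF.star w hw).1
    exact hF.edge_pos i j hij (by simp) ⟨hin u i (hF.neg u i (by simp)), hin v j (hF.neg v j (by simp))⟩

end Game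

/-! ### Falsification by colorings -/

section Coloring

variable {n ω ξ : ℕ} [NeZero ξ]

/-- The coloring `r`, changed to color `0` on `Z`. -/
def shade (Z : Finset (Fin n)) (r : Fin n → Fin ξ) (i : Fin n) : Fin ξ := if i ∈ Z then 0 else r i

/-- The coloring falsifies the literals `r` of `C`, and those literals `¬ p` of `C` that are about the
complete multipartite graph of the coloring outside `Z`. -/
structure ColorFalsifies (Z : Finset (Fin n)) (C : Clause (Var n ω ξ)) (r : Fin n → Fin ξ) : Prop where
  pos : ∀ i v, (Var.r i v, true) ∈ C → shade Z r i ≠ v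
  neg : ∀ i v, (Var.r i v, false) ∈ C → shade Z r i = v
  edge : ∀ i j h, (Var.edge i j h, false) ∈ C → i ∉ Z ∧ j ∉ Z ∧ r i ≠ r j

variable {Z : Finset (Fin n)} {C : Clause (Var n ω ξ)} {r : Fin n → Fin ξ}

lemma not_colorFalsifies_of_mem (hC : C ∈ colorClauses n ω ξ) : ¬ ColorFalsifies Z C r := by
  intro hF
  rcases hC with ⟨i, rfl⟩ | ⟨u, v, i, huv, rfl⟩ | ⟨v, i, j, hij, rfl⟩
  · exact hF.pos i (shade Z r i) (by simp) rfl
  · exact huv ((hF.neg i u (by simp)).symm.trans (hF.neg i v (by simp)))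
  · obtain ⟨hi, hj, hne⟩ := hF.edge i j hij (by simp)
    have h1 := hF.neg i v (by simp)
    have h2 := hF.neg j v (by simp)
    rw [shade, if_neg hi] at h1
    rw [shade, if_neg hj] at h2
    exact hne (h1.trans h2.symm)

lemma ColorFalsifies.of_subset {C₁ : Clause (Var n ω ξ)} (hF : ColorFalsifies Z C r)
    (hr : ∀ i v b, (Var.r i v, b) ∈ C₁ → (Var.r i v, b) ∈ C)
    (hp : ∀ i j h, (Var.edge i j h, false) ∈ C₁ → (Var.edge i j h, false) ∈ C) :
    ColorFalsifies Z C₁ r :=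
  ⟨fun i v h => hF.pos i v (hr _ _ _ h), fun i v h => hF.neg i v (hr _ _ _ h),
    fun i j h hm => hF.edge i j h (hp _ _ _ hm)⟩

end Coloring

/-! ### Approximating families along a refutation -/

section Approximation

variable {n ω ξ K B ℓ P D : ℕ}

open Classical in
/-- The sets of at most `ℓ` vertices outside `Z`. -/
noncomputable def smallSets (Z : Finset (Fin n)) (ℓ : ℕ) : Finset (Finset (Fin n)) :=
  Finset.univ.filter fun X => X.card ≤ ℓ ∧ Disjoint X Z

lemma mem_smallSets {Z X : Finset (Fin n)} : X ∈ smallSets Z ℓ ↔ X.card ≤ ℓ ∧ Disjoint X Z := by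
  simp [smallSets]

lemma mem_smallSets_of_subset {Z : Finset (Fin n)} :
    ∀ X ∈ smallSets Z ℓ, ∀ W ⊆ X, W ∈ smallSets Z ℓ := by
  intro X hX W hW
  rw [mem_smallSets] at hX ⊢
  exact ⟨(Finset.card_le_card hW).trans hX.1, hX.2.mono_left hW⟩

/-- The pseudo-clique contains a member of `F`. -/
def Covers (Z : Finset (Fin n)) (F : Finset (Finset (Fin n))) (x : Sample n ω K B) : Prop :=
  ∃ X ∈ F, ∀ i ∈ X, InCore Z x i

/-- No member of `F` gets different colors. -/
def Avoids (F : Finset (Finset (Fin n))) (r : Fin n → Fin ξ) : Prop :=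
  ∀ X ∈ F, ¬ Set.InjOn r (X : Set (Fin n))

/-- The pseudo-clique contains a large minimal member of `F`. -/
def CoversLarge (Z : Finset (Fin n)) (F : Finset (Finset (Fin n))) (t : ℕ) :
    Set (Sample n ω K B) :=
  {x | ∃ X ∈ minimalMembers F X.card, t ≤ X.card ∧ ∀ i ∈ X, InCore Z x i}

variable {Z : Finset (Fin n)} {F F₁ F₂ : Finset (Finset (Fin n))}

/-- At most `P ^ j` minimal members have size `j`, and each lies in the core with probability at
most `K^{-j}`; the geometric series has ratio at most `1/2`. -/
lemma pr_coversLarge_le [NeZero ω] [NeZero B] [NeZero K] (hP : 2 ≤ P) (hPK : 2 * P ≤ K)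
    (hF : IsClosedFamily P (smallSets Z ℓ) F) (t : ℕ) :
    pr (CoversLarge Z F t : Set (Sample n ω K B)) ≤ 2 * (P / K : ℝ) ^ t := by
  classical
  have hK : (0 : ℝ) < K := by exact_mod_cast NeZero.pos K
  have ha : (P / K : ℝ) ≤ 1 / 2 := by
    rw [div_le_div_iff₀ hK (by norm_num)]
    exact_mod_cast (by omega : P * 2 ≤ 1 * K)
  have hsub : (CoversLarge Z F t : Set (Sample n ω K B)) ⊆
      ⋃ j ∈ Finset.Ico t (ℓ + 1), ⋃ X ∈ minimalMembers F j, {x | ∀ i ∈ X, InCore Z x i} := by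
    rintro x ⟨X, hX, ht, hin⟩
    have hc : X.card ≤ ℓ := (mem_smallSets.mp (hF.1 (mem_minimalMembers.mp hX).1)).1
    simp only [Set.mem_iUnion]
    exact ⟨X.card, Finset.mem_Ico.mpr ⟨ht, by omega⟩, X, hX, hin⟩
  calc _ ≤ _ := pr_mono hsub
    _ ≤ ∑ j ∈ Finset.Ico t (ℓ + 1), pr (⋃ X ∈ minimalMembers F j,
          {x : Sample n ω K B | ∀ i ∈ X, InCore Z x i}) := pr_biUnion_le _ _
    _ ≤ ∑ j ∈ Finset.Ico t (ℓ + 1), (P / K : ℝ) ^ j := by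
        refine Finset.sum_le_sum fun j _ => (pr_biUnion_le _ _).trans ?_
        calc _ ≤ ∑ X ∈ minimalMembers F j, (1 / K : ℝ) ^ j := by
              refine Finset.sum_le_sum fun X hX => ?_
              rw [← (mem_minimalMembers.mp hX).2.1]
              exact pr_subset_core_le Z X
          _ = (minimalMembers F j).card * (1 / K : ℝ) ^ j := by simp
          _ ≤ (P : ℝ) ^ j * (1 / K : ℝ) ^ j := by
              gcongr
              exact_mod_cast (card_minimalMembers_le hP mem_smallSets_of_subset hF j).trans
                (Nat.pow_le_pow_left (by omega) j)
          _ = _ := by rw [← mul_pow]; congr 1; ring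
    _ ≤ (P / K : ℝ) ^ t / (1 - P / K) :=
        geom_sum_Ico_le_of_lt_one (by positivity) (by linarith)
    _ ≤ 2 * (P / K : ℝ) ^ t := by
        rw [div_le_iff₀ (by linarith)]
        have : 0 ≤ (P / K : ℝ) ^ t := by positivity
        nlinarith

lemma Covers.exists_minimal {x : Sample n ω K B} (h : Covers Z F x) :
    ∃ X ∈ minimalMembers F X.card, ∀ i ∈ X, InCore Z x i := by
  obtain ⟨X, hX, hin⟩ := h
  obtain ⟨W, hWX, hW⟩ := exists_minimalMember hX
  exact ⟨W, hW, fun i hi => hin i (hWX hi)⟩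

lemma mem_smallSets_of_inCore {X : Finset (Fin n)} {x : Sample n ω K B} (hX : X.card ≤ ℓ)
    (h : ∀ i ∈ X, InCore Z x i) : X ∈ smallSets Z ℓ :=
  mem_smallSets.mpr ⟨hX, Finset.disjoint_left.mpr fun i hi => (h i hi).1⟩

/-- Two minimal members in the core with at most `ℓ/2` vertices each have a union that is still
small, and closure under supersets puts it into both families. -/
lemma Covers.inter {x : Sample n ω K B} (hF₁ : IsClosedFamily P (smallSets Z ℓ) F₁)
    (hF₂ : IsClosedFamily P (smallSets Z ℓ) F₂) (h₁ : Covers Z F₁ x) (h₂ : Covers Z F₂ x)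
    (hx₁ : x ∉ CoversLarge Z F₁ (ℓ / 2 + 1)) (hx₂ : x ∉ CoversLarge Z F₂ (ℓ / 2 + 1)) :
    Covers Z (F₁ ∩ F₂) x := by
  obtain ⟨X₁, hX₁, hin₁⟩ := h₁.exists_minimal
  obtain ⟨X₂, hX₂, hin₂⟩ := h₂.exists_minimal
  have hc₁ : X₁.card < ℓ / 2 + 1 := by
    by_contra! hle; exact hx₁ ⟨X₁, hX₁, hle, hin₁⟩
  have hc₂ : X₂.card < ℓ / 2 + 1 := by
    by_contra! hle; exact hx₂ ⟨X₂, hX₂, hle, hin₂⟩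
  have hin : ∀ i ∈ X₁ ∪ X₂, InCore Z x i := by
    intro i hi
    rcases Finset.mem_union.mp hi with hi | hi
    · exact hin₁ i hi
    · exact hin₂ i hi
  have hU : X₁ ∪ X₂ ∈ smallSets Z ℓ :=
    mem_smallSets_of_inCore (by have := Finset.card_union_le X₁ X₂; omega) hin
  exact ⟨X₁ ∪ X₂, Finset.mem_inter.mpr
    ⟨hF₁.mem_of_subset (mem_minimalMembers.mp hX₁).1 hU Finset.subset_union_left,
      hF₂.mem_of_subset (mem_minimalMembers.mp hX₂).1 hU Finset.subset_union_right⟩, hin⟩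

lemma Covers.mono {x : Sample n ω K B} (h : F₁ ⊆ F₂) : Covers Z F₁ x → Covers Z F₂ x :=
  fun ⟨X, hX, hin⟩ => ⟨X, h hX, hin⟩

lemma edge_mem_insert_edge {C : Clause (Var n ω ξ)} {i j a b : Fin n} {hij : i ≠ j} {hab : a ≠ b}
    {c d : Bool} (h : (Var.edge a b hab, c) ∈ insert (Var.edge i j hij, d) C) :
    (((a = i ∧ b = j) ∨ (a = j ∧ b = i)) ∧ c = d) ∨ (Var.edge a b hab, c) ∈ C := by
  rcases Finset.mem_insert.mp h with h | h
  · left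
    simpa [Var.edge] using h
  · exact Or.inr h

variable [NeZero ξ]

/-- `F` approximates the clause `C`, up to the errors `EU` and `EV`. -/
def Approximates (cls : Fin ω → Fin B) (Z : Finset (Fin n)) (C : Clause (Var n ω ξ))
    (F : Finset (Finset (Fin n))) (EU : Set (Sample n ω K B)) (EV : Set (Fin n → Fin ξ)) : Prop :=
  (∀ x ∉ EU, CliqueFalsifies cls Z C x → Covers Z F x) ∧
    ∀ r ∉ EV, ColorFalsifies Z C r → Avoids F r

/-- One resolution step: approximators of the premises give one of the conclusion. -/
lemma exists_approximates_resolvent [NeZero ω] [NeZero B] [NeZero K] {cls : Fin ω → Fin B}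
    (hcls : ∀ b, ((Finset.univ.filter fun u => cls u = b).card : ℝ) * B ≤ ω + B)
    (hP : 2 ≤ P) (hPK : 2 * P ≤ K) (hℓ : 4 * (ℓ * (ℓ - 1)) ≤ ξ)
    {C₁ C₂ C : Clause (Var n ω ξ)} (hC : IsResolvent C₁ C₂ C)
    (hF₁ : IsClosedFamily P (smallSets Z ℓ) F₁) (hF₂ : IsClosedFamily P (smallSets Z ℓ) F₂)
    {EU : Set (Sample n ω K B)} {EV : Set (Fin n → Fin ξ)}
    (hEU : ∀ x ∉ EU, ∀ u, 8 * D ≤ (starVertices cls Z x u).card)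
    (h₁ : Approximates cls Z C₁ F₁ EU EV) (h₂ : Approximates cls Z C₂ F₂ EU EV) :
    ∃ (F : Finset (Finset (Fin n))) (EU' : Set (Sample n ω K B)) (EV' : Set (Fin n → Fin ξ)),
      IsClosedFamily P (smallSets Z ℓ) F ∧
      pr EU' ≤ 4 * (P / K : ℝ) ^ (ℓ / 2 + 1) + (1 / B) ^ D +
        Real.exp (-(B / (2 * (ω + B)) * (4 * D ^ 2 : ℕ))) ∧
      pr EV' ≤ (smallSets Z ℓ).card * (1 / 4) ^ P ∧
      Approximates cls Z C F (EU ∪ EU') (EV ∪ EV') := by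
  have hξ : 1 ≤ ξ := NeZero.one_le
  have hpow : 0 ≤ (P / K : ℝ) ^ (ℓ / 2 + 1) := by positivity
  have hexp := (Real.exp_pos (-(B / (2 * (ω + B)) * (4 * D ^ 2 : ℕ)))).le
  have hBD : 0 ≤ (1 / B : ℝ) ^ D := by positivity
  have hsmall : ∀ X ∈ smallSets Z ℓ, X.card ≤ ℓ := fun X hX => (mem_smallSets.mp hX).1
  obtain ⟨v, C', D', rfl, rfl, rfl⟩ := hC
  -- As in monotone interpolation, `p_{ij}` acts as `F₁ ∨ (p_{ij} ∧ F₂)`, a variable `q` as a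
  -- disjunction, and a variable `r` as a conjunction.
  rcases v with e | ⟨u, i⟩ | ⟨i, c⟩
  · obtain ⟨⟨i, j⟩, he⟩ := e
    have hij : i ≠ j := fun h => he (Sym2.mk_isDiag_iff.mpr h)
    change Approximates cls Z (insert ((Var.edge i j hij : Var n ω ξ), true) C') F₁ EU EV at h₁
    change Approximates cls Z (insert ((Var.edge i j hij : Var n ω ξ), false) D') F₂ EU EV at h₂
    classical
    set Fp := (smallSets Z ℓ).filter fun X => {i, j} ⊆ X with hFp
    have hFpc : IsClosedFamily P (smallSets Z ℓ) Fp := isClosedFamily_filter_subset hP {i, j}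
    obtain ⟨F, hsub, hF, EV', hEV', hV⟩ := exists_closedFamily (P := P) hξ hℓ hsmall
      (Finset.union_subset hF₁.1 (hF₂.inter hFpc).1)
    -- A set of at most `ℓ/2` vertices and the pair `{i, j}` are sure to fit into `ℓ` vertices only
    -- if `ℓ/2 ≥ 2`. For smaller `ℓ`, the cores that contain the pair are counted as errors.
    refine ⟨F, CoversLarge Z F₂ (ℓ / 2 + 1) ∪
      {x | ℓ / 2 + 1 ≤ 2 ∧ ∀ k ∈ ({i, j} : Finset (Fin n)), InCore Z x k}, EV', hF, ?_, hEV', ?_, ?_⟩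
    · have hbound : pr {x : Sample n ω K B | ℓ / 2 + 1 ≤ 2 ∧
          ∀ k ∈ ({i, j} : Finset (Fin n)), InCore Z x k} ≤ (P / K : ℝ) ^ (ℓ / 2 + 1) := by
        by_cases hl : ℓ / 2 + 1 ≤ 2
        · simp only [hl, true_and]
          refine (pr_subset_core_le Z {i, j}).trans ?_
          rw [Finset.card_pair hij]
          have hK1 : (1 / K : ℝ) ≤ 1 := by
            rw [div_le_one (by exact_mod_cast NeZero.pos K)]; exact_mod_cast NeZero.one_le
          refine (pow_le_pow_of_le_one (by positivity) hK1 hl).trans ?_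
          gcongr
          exact_mod_cast (by omega : 1 ≤ P)
        · simp only [hl, false_and]
          change pr ∅ ≤ _
          rw [pr_empty]; exact hpow
      have := pr_coversLarge_le (ω := ω) (B := B) hP hPK hF₂ (ℓ / 2 + 1)
      have := pr_union_le (CoversLarge Z F₂ (ℓ / 2 + 1)) {x : Sample n ω K B | ℓ / 2 + 1 ≤ 2 ∧
          ∀ k ∈ ({i, j} : Finset (Fin n)), InCore Z x k}
      linarith
    · rintro x hx ⟨S, α, hfals⟩
      simp only [Set.mem_union, not_or] at hx
      obtain ⟨hxEU, hxL, hxp⟩ := hx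
      by_cases hin : InCore Z x i ∧ InCore Z x j
      · have hc : CliqueFalsifies cls Z (insert (Var.edge i j hij, false) D') x := by
          have hD := hfals.of_subset (C₁ := D') (fun _ _ _ => Finset.mem_union_right _)
            fun _ _ _ _ => Finset.mem_union_right _
          refine ⟨S, α, hD.injOn, hD.star, fun u k hm => hD.neg u k (by simpa [Var.edge] using hm),
            fun u k hm => hD.pos u k (by simpa [Var.edge] using hm), fun u hu => ?_,
            fun a b hab hm => hD.edge_pos a b hab (by simpa using hm), fun a b hab hm => ?_⟩
          · simpa [Var.edge] using hD.light u hu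
          · rcases edge_mem_insert_edge hm with ⟨⟨rfl, rfl⟩ | ⟨rfl, rfl⟩, -⟩ | hm
            · exact hin
            · exact hin.symm
            · exact hD.edge_neg a b hab hm
        obtain ⟨X, hX, hXin⟩ := (h₂.1 x hxEU hc).exists_minimal
        have hXc : X.card < ℓ / 2 + 1 := by
          by_contra! hle; exact hxL ⟨X, hX, hle, hXin⟩
        have hpair : ∀ k ∈ ({i, j} : Finset (Fin n)), InCore Z x k := by
          intro k hk
          rcases Finset.mem_insert.mp hk with rfl | hk
          · exact hin.1
          · rw [Finset.mem_singleton.mp hk]; exact hin.2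
        have hl : ¬ ℓ / 2 + 1 ≤ 2 := fun hl => hxp ⟨hl, hpair⟩
        have hUin : ∀ k ∈ X ∪ {i, j}, InCore Z x k := by
          intro k hk
          rcases Finset.mem_union.mp hk with hk | hk
          · exact hXin k hk
          · exact hpair k hk
        have hU : X ∪ {i, j} ∈ smallSets Z ℓ := by
          refine mem_smallSets_of_inCore ?_ hUin
          have h1 := Finset.card_union_le X {i, j}
          rw [Finset.card_pair hij] at h1
          omega
        refine ⟨X ∪ {i, j}, hsub (Finset.mem_union_right _ (Finset.mem_inter.mpr ⟨?_, ?_⟩)), hUin⟩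
        · exact hF₂.mem_of_subset (mem_minimalMembers.mp hX).1 hU Finset.subset_union_left
        · exact Finset.mem_filter.mpr ⟨hU, Finset.subset_union_right⟩
      · have hc : CliqueFalsifies cls Z (insert (Var.edge i j hij, true) C') x := by
          have hD := hfals.of_subset (C₁ := C') (fun _ _ _ => Finset.mem_union_left _)
            fun _ _ _ _ => Finset.mem_union_left _
          refine ⟨S, α, hD.injOn, hD.star, fun u k hm => hD.neg u k (by simpa [Var.edge] using hm),
            fun u k hm => hD.pos u k (by simpa [Var.edge] using hm), fun u hu => ?_,
            fun a b hab hm => ?_, fun a b hab hm => hD.edge_neg a b hab (by simpa using hm)⟩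
          · simpa [Var.edge] using hD.light u hu
          · rcases edge_mem_insert_edge hm with ⟨⟨rfl, rfl⟩ | ⟨rfl, rfl⟩, -⟩ | hm
            · exact hin
            · exact fun h => hin h.symm
            · exact hD.edge_pos a b hab hm
        exact (h₁.1 x hxEU hc).mono (Finset.subset_union_left.trans hsub)
    · intro r hr hfals
      simp only [Set.mem_union, not_or] at hr
      refine hV r hr.2 fun X hX hinj => ?_
      rcases Finset.mem_union.mp hX with hX | hX
      -- Colorings do not judge the positive literal `p_{ij}`, so the first premise is falsified
      -- along with the conclusion.
      · refine h₁.2 r hr.1 ?_ X hX hinj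
        refine hfals.of_subset (fun a b c hm => ?_) fun a b hab hm => ?_
        · exact Finset.mem_union_left _ (by simpa [Var.edge] using hm)
        · exact Finset.mem_union_left _ (by simpa using hm)
      · obtain ⟨hX₂, hXp⟩ := Finset.mem_inter.mp hX
        obtain ⟨hXs, hXij⟩ := Finset.mem_filter.mp hXp
        have hi : i ∈ X := hXij (by simp)
        have hj : j ∈ X := hXij (by simp)
        have hZ := Finset.disjoint_left.mp (mem_smallSets.mp hXs).2
        have hne : r i ≠ r j := fun h => hij (hinj hi hj h)
        refine h₂.2 r hr.1 ?_ X hX₂ hinj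
        have hD := hfals.of_subset (C₁ := D') (fun _ _ _ => Finset.mem_union_right _)
            fun _ _ _ => Finset.mem_union_right _
        refine ⟨fun a c hm => hD.pos a c (by simpa using hm),
          fun a c hm => hD.neg a c (by simpa [Var.edge] using hm), fun a b hab hm => ?_⟩
        rcases edge_mem_insert_edge hm with ⟨⟨rfl, rfl⟩ | ⟨rfl, rfl⟩, -⟩ | hm
        · exact ⟨hZ hi, hZ hj, hne⟩
        · exact ⟨hZ hj, hZ hi, hne.symm⟩
        · exact hD.edge a b hab hm
  · obtain ⟨F, hsub, hF, EV', hEV', hV⟩ := exists_closedFamily (P := P) hξ hℓ hsmall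
      (Finset.union_subset hF₁.1 hF₂.1)
    refine ⟨F, {x | (∀ i, Unsettled cls Z (C' ∪ D') x i) ∧ D ≤ (pinned cls Z (C' ∪ D') x).card} ∪
      {x | (∀ i, Unsettled cls Z (C' ∪ D') x i) ∧
        4 * D ^ 2 ≤ ∑ i, (excluded cls Z (C' ∪ D') x i).card}, EV', hF, ?_, hEV', ?_, ?_⟩
    · have h1 := pr_unsettled_pinned_le (K := K) cls Z (C' ∪ D') D
      have h2 := pr_unsettled_excluded_le (K := K) cls Z (C' ∪ D') hcls (4 * D ^ 2)
      refine (pr_union_le _ _).trans ?_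
      linarith
    · rintro x hx ⟨S, α, hfals⟩
      simp only [Set.mem_union, not_or] at hx
      obtain ⟨hxEU, hx1, hx2⟩ := hx
      have hpin : (pinned cls Z (C' ∪ D') x).card < D := by
        by_contra! h; exact hx1 ⟨hfals.unsettled, h⟩
      have hexc : ∑ i, (excluded cls Z (C' ∪ D') x i).card < 4 * D ^ 2 := by
        by_contra! h; exact hx2 ⟨hfals.unsettled, h⟩
      obtain ⟨S', hfals', hS'⟩ := hfals.exists_small (hEU x hxEU) hpin hexc
      rcases hfals'.resolve_q (u := u) (i := i) (hEU x hxEU u) hS' with h | h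
      · exact (h₁.1 x hxEU h).mono (Finset.subset_union_left.trans hsub)
      · exact (h₂.1 x hxEU h).mono (Finset.subset_union_right.trans hsub)
    · intro r hr hfals
      simp only [Set.mem_union, not_or] at hr
      refine hV r hr.2 fun X hX => ?_
      rcases Finset.mem_union.mp hX with hX | hX
      · refine h₁.2 r hr.1 (hfals.of_subset (fun a b c hm => ?_) fun a b hab hm => ?_) X hX
        · exact Finset.mem_union_left _ (by simpa using hm)
        · exact Finset.mem_union_left _ (by simpa using hm)
      · refine h₂.2 r hr.1 (hfals.of_subset (fun a b c hm => ?_) fun a b hab hm => ?_) X hX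
        · exact Finset.mem_union_right _ (by simpa using hm)
        · exact Finset.mem_union_right _ (by simpa [Var.edge] using hm)
  -- The clique side ignores `r` and falsifies both premises, while the coloring falsifies one of
  -- them. The intersection is already closed, so no color error arises.
  · refine ⟨F₁ ∩ F₂, CoversLarge Z F₁ (ℓ / 2 + 1) ∪ CoversLarge Z F₂ (ℓ / 2 + 1), ∅,
      hF₁.inter hF₂, ?_, by rw [pr_empty]; positivity, ?_, ?_⟩
    · have := pr_coversLarge_le (ω := ω) (B := B) hP hPK hF₁ (ℓ / 2 + 1)
      have := pr_coversLarge_le (ω := ω) (B := B) hP hPK hF₂ (ℓ / 2 + 1)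
      refine (pr_union_le _ _).trans ?_
      linarith
    · rintro x hx ⟨S, α, hfals⟩
      simp only [Set.mem_union, not_or] at hx
      refine Covers.inter hF₁ hF₂ (h₁.1 x hx.1 ⟨S, α, hfals.of_subset ?_ ?_⟩)
        (h₂.1 x hx.1 ⟨S, α, hfals.of_subset ?_ ?_⟩) hx.2.1 hx.2.2
      · exact fun u k b hm => Finset.mem_union_left _ (by simpa using hm)
      · exact fun a b hab d hm => Finset.mem_union_left _ (by simpa [Var.edge] using hm)
      · exact fun u k b hm => Finset.mem_union_right _ (by simpa using hm)
      · exact fun a b hab d hm => Finset.mem_union_right _ (by simpa [Var.edge] using hm)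
    · intro r hr hfals X hX
      simp only [Set.union_empty] at hr
      obtain ⟨hX₁, hX₂⟩ := Finset.mem_inter.mp hX
      have hC' := hfals.of_subset (C₁ := C') (fun _ _ _ => Finset.mem_union_left _)
            fun _ _ _ => Finset.mem_union_left _
      have hD' := hfals.of_subset (C₁ := D') (fun _ _ _ => Finset.mem_union_right _)
            fun _ _ _ => Finset.mem_union_right _
      by_cases hc : shade Z r i = c
      · refine h₂.2 r hr ⟨fun a d hm => hD'.pos a d (by simpa using hm), fun a d hm => ?_,
          fun a b hab hm => hD'.edge a b hab (by simpa [Var.edge] using hm)⟩ X hX₂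
        rcases Finset.mem_insert.mp hm with hm | hm
        · simp only [Prod.mk.injEq, Var.r.injEq, and_true] at hm
          obtain ⟨rfl, rfl⟩ := hm
          exact hc
        · exact hD'.neg a d hm
      · refine h₁.2 r hr ⟨fun a d hm => ?_, fun a d hm => hC'.neg a d (by simpa using hm),
          fun a b hab hm => hC'.edge a b hab (by simpa using hm)⟩ X hX₁
        rcases Finset.mem_insert.mp hm with hm | hm
        · simp only [Prod.mk.injEq, Var.r.injEq, and_true] at hm
          obtain ⟨rfl, rfl⟩ := hm
          exact hc
        · exact hC'.pos a d hm

/-- A refutation is long, unless the additional clauses are falsified too often. -/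
theorem one_le_or_le_of_isRefutation [NeZero ω] [NeZero B] [NeZero K] {cls : Fin ω → Fin B}
    (hcls : ∀ b, ((Finset.univ.filter fun u => cls u = b).card : ℝ) * B ≤ ω + B)
    (hP : 2 ≤ P) (hPK : 2 * P ≤ K) (hℓ : 4 * (ℓ * (ℓ - 1)) ≤ ξ) (hD : 1 ≤ D)
    {ΔA ΔB : Set (Clause (Var n ω ξ))} {π : List (Clause (Var n ω ξ))}
    (hπ : IsRefutation (cliqueClauses n ω ξ ∪ colorClauses n ω ξ ∪ (ΔA ∪ ΔB)) π)
    {eU eV aU aS aV : ℝ}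
    (heU : 4 * (P / K : ℝ) ^ (ℓ / 2 + 1) + (1 / B) ^ D +
        Real.exp (-(B / (2 * (ω + B)) * (4 * D ^ 2 : ℕ))) ≤ eU)
    (heV : (smallSets Z ℓ).card * (1 / 4) ^ P ≤ eV)
    (haU : pr {x : Sample n ω K B | ∃ C ∈ ΔA, CliqueFalsifies cls Z C x} ≤ aU)
    (haS : pr {x : Sample n ω K B | ∃ u, (starVertices cls Z x u).card < 8 * D} ≤ aS)
    (haV : pr {r : Fin n → Fin ξ | ∃ C ∈ ΔB, ColorFalsifies Z C r} ≤ aV) :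
    1 ≤ aU + aS + π.length * eU ∨ 3 / 4 ≤ aV + π.length * eV := by
  have hξ : 1 ≤ ξ := NeZero.one_le
  -- The errors accumulate along the refutation. They start with the falsified auxiliary clauses and
  -- the restrictions that leave some member too few options.
  have main : ∀ t ≤ π.length, ∃ (EU : Set (Sample n ω K B)) (EV : Set (Fin n → Fin ξ)),
      pr EU ≤ aU + aS + t * eU ∧ pr EV ≤ aV + t * eV ∧
      (∀ x ∉ EU, ∀ u, 8 * D ≤ (starVertices cls Z x u).card) ∧
      (∀ x ∉ EU, ∀ C ∈ ΔA, ¬ CliqueFalsifies cls Z C x) ∧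
      (∀ r ∉ EV, ∀ C ∈ ΔB, ¬ ColorFalsifies Z C r) ∧
      ∀ i : Fin π.length, i.1 < t → ∃ F, IsClosedFamily P (smallSets Z ℓ) F ∧
        Approximates cls Z (π.get i) F EU EV := by
    intro t
    induction t with
    | zero =>
      intro _
      refine ⟨{x | ∃ C ∈ ΔA, CliqueFalsifies cls Z C x} ∪
        {x | ∃ u, (starVertices cls Z x u).card < 8 * D}, {r | ∃ C ∈ ΔB, ColorFalsifies Z C r},
        ?_, ?_, ?_, ?_, ?_, ?_⟩
      · refine (pr_union_le _ _).trans ?_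
        push_cast; linarith
      · push_cast; linarith
      · intro x hx u
        by_contra! h
        exact hx (Or.inr ⟨u, h⟩)
      · exact fun x hx C hC h => hx (Or.inl ⟨C, hC, h⟩)
      · exact fun r hr C hC h => hr ⟨C, hC, h⟩
      · exact fun i hi => absurd hi (Nat.not_lt_zero _)
    | succ t ih =>
      intro ht
      obtain ⟨EU, EV, hEU, hEV, hstar, hΔA, hΔB, hF⟩ := ih (by omega)
      have heU0 : 0 ≤ eU := le_trans (by positivity) heU
      have heV0 : 0 ≤ eV := le_trans (by positivity) heV
      suffices h : ∃ (F : Finset (Finset (Fin n))) (EU' : Set (Sample n ω K B))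
          (EV' : Set (Fin n → Fin ξ)), IsClosedFamily P (smallSets Z ℓ) F ∧
          pr EU' ≤ eU ∧ pr EV' ≤ eV ∧
          Approximates cls Z (π.get ⟨t, ht⟩) F (EU ∪ EU') (EV ∪ EV') by
        obtain ⟨F, EU', EV', hFc, hEU', hEV', happ⟩ := h
        refine ⟨EU ∪ EU', EV ∪ EV', ?_, ?_, fun x hx => hstar x fun h => hx (Or.inl h),
          fun x hx => hΔA x fun h => hx (Or.inl h), fun r hr => hΔB r fun h => hr (Or.inl h), ?_⟩
        · refine (pr_union_le _ _).trans ?_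
          push_cast; linarith
        · refine (pr_union_le _ _).trans ?_
          push_cast; linarith
        · intro i hi
          rcases Nat.lt_succ_iff_lt_or_eq.mp hi with hi | hi
          · obtain ⟨F, hFc, hFa⟩ := hF i hi
            exact ⟨F, hFc, fun x hx => hFa.1 x fun h => hx (Or.inl h),
              fun r hr => hFa.2 r fun h => hr (Or.inl h)⟩
          · obtain rfl : i = ⟨t, ht⟩ := Fin.ext hi
            exact ⟨F, hFc, happ⟩
      have hempty : (∀ x ∉ EU, ¬ CliqueFalsifies cls Z (π.get ⟨t, ht⟩) x) → _ := fun h =>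
        (⟨∅, ∅, ∅, isClosedFamily_empty (by omega), by rwa [pr_empty], by rwa [pr_empty],
          fun x hx hf => absurd hf (h x (by simpa using hx)), fun r _ _ X hX => by simp at hX⟩ :
          ∃ (F : Finset (Finset (Fin n))) (EU' : Set (Sample n ω K B))
          (EV' : Set (Fin n → Fin ξ)), IsClosedFamily P (smallSets Z ℓ) F ∧
          pr EU' ≤ eU ∧ pr EV' ≤ eV ∧
          Approximates cls Z (π.get ⟨t, ht⟩) F (EU ∪ EU') (EV ∪ EV'))
      have hfull : (∀ r ∉ EV, ¬ ColorFalsifies Z (π.get ⟨t, ht⟩) r) → _ := fun h =>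
        (⟨smallSets Z ℓ, ∅, ∅, isClosedFamily_self, by rwa [pr_empty], by rwa [pr_empty],
          fun x hx hf => ⟨∅, by simp [mem_smallSets], by simp⟩,
          fun r hr hf => absurd hf (h r (by simpa using hr))⟩ :
          ∃ (F : Finset (Finset (Fin n))) (EU' : Set (Sample n ω K B))
          (EV' : Set (Fin n → Fin ξ)), IsClosedFamily P (smallSets Z ℓ) F ∧
          pr EU' ≤ eU ∧ pr EV' ≤ eV ∧
          Approximates cls Z (π.get ⟨t, ht⟩) F (EU ∪ EU') (EV ∪ EV'))
      rcases hπ.1 ⟨t, ht⟩ with ((h | h) | (h | h)) | ⟨j, k, hj, hk, hres⟩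
      · exact hempty fun x _ => not_cliqueFalsifies_of_mem h
      · exact hfull fun r _ => not_colorFalsifies_of_mem h
      · exact hempty fun x hx => hΔA x hx _ h
      · exact hfull fun r hr => hΔB r hr _ h
      · obtain ⟨F₁, hF₁, hA₁⟩ := hF j hj
        obtain ⟨F₂, hF₂, hA₂⟩ := hF k hk
        obtain ⟨F, EU', EV', hFc, h1, h2, h3⟩ := exists_approximates_resolvent hcls hP hPK hℓ hres
          hF₁ hF₂ hstar hA₁ hA₂
        exact ⟨F, EU', EV', hFc, h1.trans heU, h2.trans heV, h3⟩
  obtain ⟨EU, EV, hEU, hEV, hstar, -, -, hF⟩ := main π.length le_rfl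
  have hlast := hπ.2
  rw [List.getLast?_eq_some_iff] at hlast
  obtain ⟨ys, rfl⟩ := hlast
  have hlen : ys.length < (ys ++ [(∅ : Clause (Var n ω ξ))]).length := by simp
  obtain ⟨F, hFc, hFa⟩ := hF ⟨ys.length, hlen⟩ hlen
  simp only [List.get_eq_getElem, List.getElem_concat_length] at hFa
  rcases F.eq_empty_or_nonempty with rfl | ⟨X, hX⟩
  · left
    refine le_trans ?_ hEU
    rw [← pr_univ (Ω := Sample n ω K B)]
    refine pr_mono fun x _ => ?_
    by_contra hx
    -- The assignment on `S = ∅` still needs a default vertex; `n = 0` would contradict the lower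
    -- bound on the number of options.
    obtain ⟨X, hX, -⟩ := hFa.1 x hx ⟨∅, fun _ => ⟨0, by
      rcases Nat.eq_zero_or_pos n with rfl | hn
      · have := hstar x hx 0
        rw [Finset.eq_empty_of_isEmpty (starVertices cls Z x 0), Finset.card_empty] at this
        omega
      · exact hn⟩, by simp, by simp, by simp, by simp,
      fun u _ => by
        have := hstar x hx u
        rw [Finset.filter_false_of_mem (by simp), Finset.card_empty]
        omega, by simp, by simp⟩
    simp at hX
  · right
    have : Nonempty (Fin n → Fin ξ) := ⟨fun _ => ⟨0, hξ⟩⟩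
    have h1 := pr_not_injOn_le (A := (Set.univ : Set (Fin n → Fin ξ))) (W := ∅) hξ hℓ
      (mem_smallSets.mp (hFc.1 hX)).1 (by simp) (by simp)
    rw [pr_univ] at h1
    have h2 : pr {r : Fin n → Fin ξ | r ∈ Set.univ ∧ ¬ Set.InjOn r (X : Set (Fin n))}ᶜ ≤ pr EV := by
      refine pr_mono fun r hr => ?_
      by_contra hrE
      exact hr ⟨trivial, hFa.2 r hrE ⟨by simp, by simp, by simp⟩ X hX⟩
    rw [pr_compl] at h2
    linarith

end Approximation

/-! ### Many auxiliary clauses: splitting by independence -/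

section Assignments

variable {n ω ξ K B : ℕ}

/-- The restriction, with the unset variables set to false, falsifies the literals `p` and `q`
of `C`. -/
structure SampleFalsifies (Z : Finset (Fin n)) (C : Clause (Var n ω ξ)) (x : Sample n ω K B) :
    Prop where
  neg : ∀ u i, (Var.q u i, false) ∈ C → IsOne Z x u i
  pos : ∀ u i, (Var.q u i, true) ∈ C → ¬ IsOne Z x u i
  edge_pos : ∀ i j h, (Var.edge i j h, true) ∈ C → ¬ (InCore Z x i ∧ InCore Z x j)
  edge_neg : ∀ i j h, (Var.edge i j h, false) ∈ C → InCore Z x i ∧ InCore Z x j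

open Classical in
/-- The truth assignment given by a restriction and a coloring. -/
noncomputable def assignment (Z : Finset (Fin n)) (x : Sample n ω K B) (r : Fin n → Fin ξ) :
    Var n ω ξ → Bool
  | Var.p e => decide (∀ i ∈ e.1, InCore Z x i)
  | Var.q u i => decide (IsOne Z x u i)
  | Var.r i v => decide (r i = v)

lemma not_satisfies_assignment [NeZero ξ] {C : Clause (Var n ω ξ)} {x : Sample n ω K B}
    {r : Fin n → Fin ξ} (hx : SampleFalsifies ∅ C x) (hr : ColorFalsifies ∅ C r) :
    ¬ Satisfies (assignment ∅ x r) C := by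
  classical
  rintro ⟨⟨v, b⟩, hl, hv⟩
  rcases v with ⟨⟨i, j⟩, he⟩ | ⟨u, i⟩ | ⟨i, c⟩
  · have hij : i ≠ j := fun h => he (Sym2.mk_isDiag_iff.mpr h)
    have hiff : (∀ k ∈ s(i, j), InCore ∅ x k) ↔ InCore ∅ x i ∧ InCore ∅ x j := by simp
    change ((Var.edge i j hij, b) : Literal (Var n ω ξ)) ∈ C at hl
    change decide (∀ k ∈ s(i, j), InCore ∅ x k) = b at hv
    cases b
    · exact of_decide_eq_false hv (hiff.mpr (hx.edge_neg i j hij hl))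
    · exact hx.edge_pos i j hij hl (hiff.mp (of_decide_eq_true hv))
  · cases b
    · exact of_decide_eq_false hv (hx.neg u i hl)
    · exact hx.pos u i hl (of_decide_eq_true hv)
  · cases b
    · exact of_decide_eq_false hv (by simpa [shade] using hr.neg i c hl)
    · exact hr.pos i c hl (by simpa [shade] using (of_decide_eq_true hv))

variable {cls : Fin ω → Fin B} {Z : Finset (Fin n)} {C : Clause (Var n ω ξ)}

lemma avg_one_or_star [NeZero ω] [NeZero B] (u : Fin ω) (b : Fin B) :
    (avg fun s : VertexState ω B => if s.1 then (if s.2.2 = b then (1 : ℝ) else 0)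
      else (if s.2.1 = u then 1 else 0)) = (1 + ω / B) * (1 / (2 * ω)) := by
  have hω : (0 : ℝ) < ω := by exact_mod_cast NeZero.pos ω
  have hB : (0 : ℝ) < B := by exact_mod_cast NeZero.pos B
  have h : ∀ g : Fin ω, (avg fun _ : Fin B => if g = u then (1 : ℝ) else 0) =
      if g = u then 1 else 0 := fun g => avg_const _
  rw [avg_vertexState]
  simp only [if_true, Bool.false_eq_true, if_false, avg_const, h, avg_ite_eq]
  field_simp
  ring

lemma avg_one [NeZero ω] [NeZero B] (u : Fin ω) :
    (avg fun s : VertexState ω B => if s.1 then (0 : ℝ) else (if s.2.1 = u then 1 else 0)) =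
      1 / (2 * ω) := by
  have h : ∀ g : Fin ω, (avg fun _ : Fin B => if g = u then (1 : ℝ) else 0) =
      if g = u then 1 else 0 := fun g => avg_const _
  rw [avg_vertexState]
  simp only [if_true, Bool.false_eq_true, if_false, avg_const, h, avg_ite_eq]
  ring

variable (C) in
open Classical in
/-- The vertices about which `C` has a literal `¬ q`. -/
noncomputable def negVertices : Finset (Fin n) :=
  Finset.univ.filter fun i => ∃ u, (Var.q u i, false) ∈ C

lemma Falsifies.oneOrStar {x : Sample n ω K B} {S : Finset (Fin ω)} {α : Fin ω → Fin n}
    (hF : Falsifies cls Z C x S α) {u : Fin ω} {i : Fin n} (hu : (Var.q u i, false) ∈ C) :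
    InCore Z x i ∧
      if (x.2 i).1 then (x.2 i).2.2 = cls u else (x.2 i).2.1 = u := by
  rcases hF.neg u i hu with h | ⟨h, rfl⟩
  · exact ⟨h.1, by simp [h.2.1, h.2.2]⟩
  · have := hF.star u h
    exact ⟨this.1, by simp [this.2.1, this.2.2]⟩

/-- A clause with many literals `¬ q` is seldom falsified. -/
lemma pr_cliqueFalsifies_le_pow [NeZero ω] [NeZero B] [NeZero K] :
    pr {x : Sample n ω K B | CliqueFalsifies cls Z C x} ≤
      ((1 + ω / B) * (1 / (2 * ω * K))) ^ (negVertices C).card := by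
  classical
  have hu : ∀ i, ∃ u, i ∈ negVertices C → (Var.q u i, false) ∈ C := by
    intro i
    by_cases h : i ∈ negVertices C
    · obtain ⟨u, hu⟩ := (by simpa [negVertices] using h : ∃ u, (Var.q u i, false) ∈ C)
      exact ⟨u, fun _ => hu⟩
    · exact ⟨0, fun h' => absurd h' h⟩
  choose g hg using hu
  -- A vertex with a negative literal must be in the core, which has probability at most `1/K`, and
  -- either be fixed to `g i`, with probability `1/(2ω)`, or be free for its class, with probability
  -- `1/(2B)`.
  let f : Fin n → Fin K → VertexState ω B → ℝ := fun i a s =>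
    if i ∈ negVertices C then (if a = 0 then (if s.1 then (if s.2.2 = cls (g i) then (1 : ℝ) else 0)
      else (if s.2.1 = g i then 1 else 0)) else 0) else 1
  have hf0 : ∀ i a s, 0 ≤ f i a s := by
    intro i a s; simp only [f]; split_ifs <;> simp
  refine (pr_le_avg (f := fun x => ∏ i, f i (x.1 i) (x.2 i)) ?_ ?_).trans ?_
  · exact fun x => Finset.prod_nonneg fun i _ => hf0 i _ _
  · rintro x ⟨S, α, hF⟩
    refine (Finset.prod_eq_one fun i _ => ?_).ge
    by_cases hi : i ∈ negVertices C
    · obtain ⟨⟨-, h1⟩, h2⟩ := hF.oneOrStar (hg i hi)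
      have h1' : x.1 i = 0 := Fin.ext h1
      by_cases hs : (x.2 i).1 = true
      · simp only [hs, if_true] at h2
        simp [f, hi, h1', hs, h2]
      · simp only [hs] at h2
        simp only [Bool.false_eq_true, if_false] at h2
        simp [f, hi, h1', hs, h2]
    · simp [f, hi]
  · rw [avg_sample_prod]
    have : ∀ i, (avg fun a => avg fun s => f i a s) =
        if i ∈ negVertices C then (1 + ω / B : ℝ) * (1 / (2 * ω * K)) else 1 := by
      intro i
      by_cases hi : i ∈ negVertices C
      · have h1 : ∀ a, (avg fun s => f i a s) =
            if a = 0 then (1 + ω / B : ℝ) * (1 / (2 * ω)) else 0 := by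
          intro a
          by_cases ha : a = 0
          · simp only [f, hi, ha, if_true]
            exact avg_one_or_star (g i) (cls (g i))
          · simp only [f, hi, ha, if_true, if_false]
            exact avg_const 0
        simp only [h1, avg_ite_eq, if_pos hi]
        rw [mul_div_assoc, div_div]
      · simp only [f, if_neg hi, avg_const]
    rw [Finset.prod_congr rfl fun i _ => this i]
    simp

/-- A clause is not much more often falsified with the help of the unset variables than without. -/
lemma pr_cliqueFalsifies_le_mul [NeZero ω] [NeZero B] [NeZero K] :
    pr {x : Sample n ω K B | CliqueFalsifies cls Z C x} ≤
      (1 + ω / B) ^ (negVertices C).card * pr {x : Sample n ω K B | SampleFalsifies Z C x} := by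
  classical
  by_cases huniq : ∀ u v i, (Var.q u i, false) ∈ C → (Var.q v i, false) ∈ C → u = v
  swap
  · push Not at huniq
    obtain ⟨u, v, i, hu, hv, hne⟩ := huniq
    have : {x : Sample n ω K B | CliqueFalsifies cls Z C x} = ∅ := by
      ext x
      simp only [Set.mem_ofPred_eq, Set.mem_empty_iff_false, iff_false]
      rintro ⟨S, α, hF⟩
      exact hne (hF.eq_of_neg_mem hu hv)
    rw [this, pr_empty]
    exact mul_nonneg (by positivity) (pr_nonneg _)
  by_cases htaut : ∃ u i, (Var.q u i, false) ∈ C ∧ (Var.q u i, true) ∈ C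
  · obtain ⟨u, i, hu, hv⟩ := htaut
    have : {x : Sample n ω K B | CliqueFalsifies cls Z C x} = ∅ := by
      ext x
      simp only [Set.mem_ofPred_eq, Set.mem_empty_iff_false, iff_false]
      rintro ⟨S, α, hF⟩
      rcases hF.neg u i hu with h | ⟨h, h'⟩
      · exact (hF.pos u i hv).1 h
      · exact (hF.pos u i hv).2 h h'
    rw [this, pr_empty]
    exact mul_nonneg (by positivity) (pr_nonneg _)
  push Not at htaut
  have hu : ∀ i, ∃ u, i ∈ negVertices C → (Var.q u i, false) ∈ C := by
    intro i
    by_cases h : i ∈ negVertices C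
    · obtain ⟨u, hu⟩ := (by simpa [negVertices] using h : ∃ u, (Var.q u i, false) ∈ C)
      exact ⟨u, fun _ => hu⟩
    · exact ⟨0, fun h' => absurd h' h⟩
  choose g hg using hu
  -- The core is fixed first and only vertex states are compared. At a vertex with a negative
  -- literal `fa` also admits the free state, which multiplies the average by `1 + ω/B`; elsewhere
  -- `fa` and `fb` agree.
  rw [pr, pr, avg_prod_type, avg_prod_type, ← avg_const_mul]
  refine avg_mono fun y => ?_
  let core : Fin n → Prop := fun i => i ∉ Z ∧ (y i).val = 0
  let fa : Fin n → VertexState ω B → ℝ := fun i s =>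
    if i ∈ negVertices C then (if s.1 then (if s.2.2 = cls (g i) then (1 : ℝ) else 0)
      else (if s.2.1 = g i then 1 else 0)) else
      if core i ∧ s.1 = false ∧ (Var.q s.2.1 i, true) ∈ C then 0 else 1
  let fb : Fin n → VertexState ω B → ℝ := fun i s =>
    if i ∈ negVertices C then (if s.1 then 0
      else (if s.2.1 = g i then 1 else 0)) else
      if core i ∧ s.1 = false ∧ (Var.q s.2.1 i, true) ∈ C then 0 else 1
  by_cases hy : (∀ i ∈ negVertices C, core i) ∧
      (∀ i j h, (Var.edge i j h, true) ∈ C → ¬ (core i ∧ core j)) ∧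
      ∀ i j h, (Var.edge i j h, false) ∈ C → core i ∧ core j
  swap
  · have : ∀ z, ({x : Sample n ω K B | CliqueFalsifies cls Z C x}.indicator 1 (y, z) : ℝ) = 0 := by
      intro z
      refine Set.indicator_of_notMem ?_ _
      rintro ⟨S, α, hF⟩
      exact hy ⟨fun i hi => (hF.oneOrStar (hg i hi)).1, hF.edge_pos, hF.edge_neg⟩
    simp only [this]
    rw [avg_const]
    exact mul_nonneg (by positivity)
      (avg_nonneg fun z => Set.indicator_nonneg (fun _ _ => zero_le_one) _)
  obtain ⟨hy1, hy2, hy3⟩ := hy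
  calc _ ≤ avg fun z : Fin n → VertexState ω B => ∏ i, fa i (z i) := by
        refine avg_mono fun z => ?_
        have hfa0 : 0 ≤ ∏ i, fa i (z i) :=
          Finset.prod_nonneg fun i _ => by simp only [fa]; split_ifs <;> simp
        by_cases hz : (y, z) ∈ {x : Sample n ω K B | CliqueFalsifies cls Z C x}
        swap
        · rwa [Set.indicator_of_notMem hz]
        rw [Set.indicator_of_mem hz]
        obtain ⟨S, α, hF⟩ := hz
        refine (Finset.prod_eq_one fun i _ => ?_).ge
        by_cases hi : i ∈ negVertices C
        · obtain ⟨-, h2⟩ := hF.oneOrStar (hg i hi)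
          simp only at h2
          by_cases hs : (z i).1 = true
          · simp only [hs, if_true] at h2
            simp [fa, hi, hs, h2]
          · simp only [hs] at h2
            simp only [Bool.false_eq_true, if_false] at h2
            simp [fa, hi, hs, h2]
        · simp only [fa, if_neg hi]
          refine if_neg ?_
          rintro ⟨h1, h2, h3⟩
          exact (hF.pos _ i h3).1 ⟨h1, h2, rfl⟩
    _ = (1 + ω / B : ℝ) ^ (negVertices C).card *
          avg fun z : Fin n → VertexState ω B => ∏ i, fb i (z i) := by
        rw [avg_pi_prod, avg_pi_prod]
        have : ∀ i, avg (fa i) = (if i ∈ negVertices C then (1 + ω / B : ℝ) else 1) * avg (fb i) := by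
          intro i
          by_cases hi : i ∈ negVertices C
          · simp only [fa, fb, if_pos hi]
            rw [avg_one, avg_one_or_star]
          · simp only [fa, fb, if_neg hi, one_mul]
        rw [Finset.prod_congr rfl fun i _ => this i, Finset.prod_mul_distrib]
        simp
    _ ≤ _ := by
        refine mul_le_mul_of_nonneg_left (avg_mono fun z => ?_) (by positivity)
        by_cases hz : ∀ i, fb i (z i) ≠ 0
        · have hmem : (y, z) ∈ {x : Sample n ω K B | SampleFalsifies Z C x} := by
            refine ⟨fun u i h => ?_, fun u i h h1 => ?_, hy2, hy3⟩
            · have hi : i ∈ negVertices C := by simpa [negVertices] using ⟨u, h⟩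
              have := hz i
              simp only [fb, if_pos hi] at this
              refine ⟨hy1 i hi, ?_, ?_⟩
              · by_contra hs
                simp [hs] at this
              · rw [huniq u (g i) i h (hg i hi)]
                by_contra hs
                simp [hs] at this
            · have := hz i
              have hi : i ∉ negVertices C := by
                intro hi
                simp only [fb, if_pos hi] at this
                have hs : (z i).2.1 = g i := by
                  by_contra hs
                  simp [hs] at this
                exact htaut (g i) i (hg i hi) (by rw [← hs, h1.2.2]; exact h)
              simp only [fb, if_neg hi] at this
              refine this (if_pos ⟨h1.1, h1.2.1, ?_⟩)
              rw [h1.2.2]; exact h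
          rw [Set.indicator_of_mem hmem]
          refine Finset.prod_le_one (fun i _ => ?_) fun i _ => ?_
          · simp only [fb]; split_ifs <;> simp
          · simp only [fb]; split_ifs <;> simp
        · push Not at hz
          obtain ⟨i, hi⟩ := hz
          rw [Finset.prod_eq_zero (Finset.mem_univ i) hi]
          exact Set.indicator_nonneg (fun _ _ => zero_le_one) _

/-- A clause that the restrictions falsify seldom is falsified seldom with the help of the unset
variables. -/
lemma pr_cliqueFalsifies_le [NeZero ω] [NeZero B] [NeZero K] {d : ℕ} (hd : 32 ≤ d)
    (hx : 128 * (1 + ω / B : ℝ) ^ 2 ≤ ω * K)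
    (hα : pr {x : Sample n ω K B | SampleFalsifies Z C x} ≤ 4 / d ^ 2) :
    pr {x : Sample n ω K B | CliqueFalsifies cls Z C x} ≤ 1 / (8 * d) := by
  have hω : (0 : ℝ) < ω := by exact_mod_cast NeZero.pos ω
  have hK : (0 : ℝ) < K := by exact_mod_cast NeZero.pos K
  have hd' : (32 : ℝ) ≤ d := by exact_mod_cast hd
  have h1 := pr_cliqueFalsifies_le_mul (K := K) (cls := cls) (Z := Z) (C := C)
  have h2 := pr_cliqueFalsifies_le_pow (K := K) (cls := cls) (Z := Z) (C := C)
  set t := pr {x : Sample n ω K B | CliqueFalsifies cls Z C x}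
  set w := (negVertices C).card
  have ht : 0 ≤ t := pr_nonneg _
  have hα0 := pr_nonneg {x : Sample n ω K B | SampleFalsifies Z C x}
  rcases Nat.eq_zero_or_pos w with hw | hw
  · rw [hw, pow_zero, one_mul] at h1
    refine (h1.trans hα).trans ?_
    rw [div_le_div_iff₀ (by positivity) (by positivity)]
    nlinarith
  -- Multiplying the two bounds for `t` lets the smallness of the second pay for the loss `(1 + ω/B)
  -- ^ w` in the first. The base is at most `1/256`, and the square root of `4/(256 d²)` is
  -- `1/(8d)`.
  · refine abs_le_of_sq_le_sq' ?_ (by positivity) |>.2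
    have hbase : (1 + ω / B : ℝ) * ((1 + ω / B) * (1 / (2 * ω * K))) ≤ 1 / 256 := by
      rw [← mul_assoc, ← sq, mul_one_div, div_le_div_iff₀ (by positivity) (by norm_num)]
      linarith
    calc t ^ 2 = t * t := sq t
      _ ≤ ((1 + ω / B) ^ w * pr {x : Sample n ω K B | SampleFalsifies Z C x}) *
          ((1 + ω / B) * (1 / (2 * ω * K))) ^ w := by gcongr
      _ = ((1 + ω / B : ℝ) * ((1 + ω / B) * (1 / (2 * ω * K)))) ^ w *
          pr {x : Sample n ω K B | SampleFalsifies Z C x} := by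
          rw [mul_pow (1 + ω / B : ℝ) ((1 + ω / B) * _)]; ring
      _ ≤ (1 / 256) ^ w * (4 / d ^ 2) := by gcongr
      _ ≤ (1 / 256) ^ 1 * (4 / d ^ 2) := by
          gcongr ?_ * _
          exact pow_le_pow_of_le_one (by norm_num) (by norm_num) hw
      _ = (1 / (8 * d)) ^ 2 := by field_simp; norm_num

/-- If the random assignments seldom falsify a clause of `Δ`, then each of these clauses is seldom
falsified by a restriction, or else almost all colorings satisfy it. -/
lemma exists_split [NeZero ω] [NeZero ξ] [NeZero B] [NeZero K] {d : ℕ} (hd : 32 ≤ d)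
    (hx : 128 * (1 + ω / B : ℝ) ^ 2 ≤ ω * K) {Δ : Finset (Clause (Var n ω ξ))} (hΔ : Δ.card ≤ d)
    (h : pr {w : (Fin n → Fin ξ) × Sample n ω K B |
      ¬ ∀ C ∈ Δ, Satisfies (assignment ∅ w.2 w.1) C} ≤ 1 / d ^ 2) :
    ∃ ΔA ΔB : Set (Clause (Var n ω ξ)), (Δ : Set (Clause (Var n ω ξ))) ⊆ ΔA ∪ ΔB ∧
      pr {x : Sample n ω K B | ∃ C ∈ ΔA, CliqueFalsifies cls ∅ C x} ≤ 1 / 8 ∧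
      pr {r : Fin n → Fin ξ | ∃ C ∈ ΔB, ColorFalsifies ∅ C r} ≤ 1 / 4 := by
  classical
  have hd' : (32 : ℝ) ≤ d := by exact_mod_cast hd
  -- By independence, a coloring that falsifies a clause above this threshold fails with conditional
  -- probability at least `4/d²`. As the total failure is at most `1/d²`, at most a quarter of the
  -- colorings do so.
  set ΔA := Δ.filter fun C => pr {x : Sample n ω K B | SampleFalsifies ∅ C x} ≤ 4 / d ^ 2
  set ΔB := Δ.filter fun C => ¬ pr {x : Sample n ω K B | SampleFalsifies ∅ C x} ≤ 4 / d ^ 2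
  refine ⟨ΔA, ΔB, ?_, ?_, ?_⟩
  · rw [← Finset.coe_union, Finset.filter_union_filter_not_eq]
  · have hsub : {x : Sample n ω K B | ∃ C ∈ (ΔA : Set (Clause (Var n ω ξ))), CliqueFalsifies cls ∅ C x} ⊆
        ⋃ C ∈ ΔA, {x | CliqueFalsifies cls ∅ C x} := by
      rintro x ⟨C, hC, hF⟩
      simp only [Set.mem_iUnion]
      exact ⟨C, hC, hF⟩
    refine (pr_mono hsub).trans ((pr_biUnion_le _ _).trans ?_)
    refine (Finset.sum_le_card_nsmul _ _ (1 / (8 * d) : ℝ) fun C hC =>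
      pr_cliqueFalsifies_le hd hx (Finset.mem_filter.mp hC).2).trans ?_
    have : (ΔA.card : ℝ) ≤ d := by
      exact_mod_cast (Finset.card_le_card (Finset.filter_subset _ _)).trans hΔ
    rw [nsmul_eq_mul, mul_one_div, div_le_div_iff₀ (by positivity) (by norm_num)]
    linarith
  · have key : 4 / (d : ℝ) ^ 2 *
        pr {r : Fin n → Fin ξ | ∃ C ∈ (ΔB : Set (Clause (Var n ω ξ))), ColorFalsifies ∅ C r} ≤
        1 / d ^ 2 := by
      refine le_trans ?_ h
      rw [pr, pr, avg_prod_type, ← avg_const_mul]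
      refine avg_mono fun r => ?_
      by_cases hr : r ∈ {r : Fin n → Fin ξ | ∃ C ∈ (ΔB : Set (Clause (Var n ω ξ))), ColorFalsifies ∅ C r}
      · rw [Set.indicator_of_mem hr]
        obtain ⟨C, hC, hF⟩ := hr
        obtain ⟨hCΔ, hlt⟩ := Finset.mem_filter.mp (Finset.mem_coe.mp hC)
        rw [Pi.one_apply, mul_one]
        refine (not_le.mp hlt).le.trans (avg_mono fun x => ?_)
        by_cases hx : x ∈ {x : Sample n ω K B | SampleFalsifies ∅ C x}
        · rw [Set.indicator_of_mem hx, Set.indicator_of_mem]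
          · simp
          · exact fun hall => not_satisfies_assignment hx hF (hall C hCΔ)
        · rw [Set.indicator_of_notMem hx]
          exact Set.indicator_nonneg (fun _ _ => zero_le_one) _
      · rw [Set.indicator_of_notMem hr, mul_zero]
        exact avg_nonneg fun x => Set.indicator_nonneg (fun _ _ => zero_le_one) _
    rw [div_mul_eq_mul_div, div_le_div_iff_of_pos_right (by positivity)] at key
    linarith

end Assignments

/-! ### Choice of a sample by averaging -/

section Sampling

variable {V : Type*} [DecidableEq V] {Ψ : Set (Clause V)} {δ : ℝ} {S : Type*}

/-- Some set of auxiliary clauses is satisfied by the random assignment `a` with probability at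
least `1 - δ`. -/
lemma RandomRefutation.exists_le_pr (R : RandomRefutation Ψ δ S) {Ω : Type*} [Fintype Ω]
    [Nonempty Ω] (a : Ω → V → Bool) :
    ∃ s, 1 - δ ≤ pr {w | ∀ C ∈ R.aux s, Satisfies (a w) C} := by
  classical
  obtain ⟨s₁, -⟩ := R.prob.support_nonempty
  let G : S → Set Ω := fun s => {w | ∀ C ∈ R.aux s, Satisfies (a w) C}
  -- `S` may be infinite, but the events `G s` are subsets of the finite `Ω`, so a best sample
  -- exists.
  obtain ⟨_, ⟨s₀, rfl⟩, hmax⟩ := Set.exists_max_image (Set.range G) pr (Set.toFinite _) ⟨_, s₁, rfl⟩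
  refine ⟨s₀, ?_⟩
  have hN : (0 : ℝ) < Fintype.card Ω := by exact_mod_cast Fintype.card_pos
  have hcard : ∀ s, ((Finset.univ.filter (· ∈ G s)).card : ℝ) ≤ Fintype.card Ω * pr (G s₀) := by
    intro s
    refine le_trans (le_of_eq ?_) (mul_le_mul_of_nonneg_left (hmax _ ⟨s, rfl⟩) hN.le)
    rw [pr, avg, mul_div_cancel₀ _ hN.ne']
    simp only [Set.indicator_apply, Pi.one_apply]
    rw [Finset.card_filter]
    push_cast
    rfl
  have hsum : (Fintype.card Ω : ℝ≥0∞) * ENNReal.ofReal (1 - δ) ≤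
      ENNReal.ofReal (Fintype.card Ω * pr (G s₀)) := by
    calc (Fintype.card Ω : ℝ≥0∞) * ENNReal.ofReal (1 - δ)
        = ∑ _w : Ω, ENNReal.ofReal (1 - δ) := by simp
      _ ≤ ∑ w : Ω, ∑' s, {s | ∀ C ∈ R.aux s, Satisfies (a w) C}.indicator R.prob s := by
          refine Finset.sum_le_sum fun w _ => ?_
          rw [← PMF.toOuterMeasure_apply]
          exact R.satisfied (a w)
      _ = ∑' s, ∑ w : Ω, {s | ∀ C ∈ R.aux s, Satisfies (a w) C}.indicator R.prob s :=
          (Summable.tsum_finsetSum fun _ _ => ENNReal.summable).symm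
      _ ≤ ∑' s, R.prob s * ENNReal.ofReal (Fintype.card Ω * pr (G s₀)) := by
          refine ENNReal.tsum_le_tsum fun s => ?_
          have : ∑ w : Ω, {s | ∀ C ∈ R.aux s, Satisfies (a w) C}.indicator R.prob s =
              R.prob s * ((Finset.univ.filter (· ∈ G s)).card : ℝ≥0∞) := by
            simp only [Set.indicator_apply, Set.mem_ofPred_eq, ← Finset.sum_filter,
              Finset.sum_const, nsmul_eq_mul, G]
            rw [mul_comm]
          rw [this]
          gcongr
          rw [← ENNReal.ofReal_natCast]
          exact ENNReal.ofReal_le_ofReal (hcard s)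
      _ = ENNReal.ofReal (Fintype.card Ω * pr (G s₀)) := by
          rw [ENNReal.tsum_mul_right, R.prob.tsum_coe, one_mul]
  rw [← ENNReal.ofReal_natCast, ← ENNReal.ofReal_mul hN.le,
    ENNReal.ofReal_le_ofReal_iff (mul_nonneg hN.le (pr_nonneg _))] at hsum
  exact le_of_mul_le_mul_left hsum hN

end Sampling

/-! ### Few auxiliary clauses: deletion of vertices -/

section FewClauses

variable {n ω ξ K B : ℕ} [NeZero ξ]

/-- The truth assignment for the graph without edges, where every vertex has color `0`. -/
def emptyAssignment : Var n ω ξ → Bool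
  | Var.p _ => false
  | Var.q _ _ => false
  | Var.r _ v => decide (v = 0)

/-- A true literal names a vertex `i`. Once `i` is in `Z` it never joins the core, so a negative `p`
or `q` literal stays true for all restrictions; and it has color `0`, so an `r` literal stays true
for all colorings. -/
lemma exists_vertex_of_satisfies (cls : Fin ω → Fin B) {C : Clause (Var n ω ξ)}
    (hC : Satisfies emptyAssignment C) :
    ∃ i, ∀ Z : Finset (Fin n), i ∈ Z → (∀ x : Sample n ω K B, ¬ CliqueFalsifies cls Z C x) ∨
      ∀ r, ¬ ColorFalsifies Z C r := by
  obtain ⟨⟨v, b⟩, hl, hv⟩ := hC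
  rcases v with ⟨⟨i, j⟩, he⟩ | ⟨u, i⟩ | ⟨i, c⟩
  · have hij : i ≠ j := fun h => he (Sym2.mk_isDiag_iff.mpr h)
    obtain rfl : false = b := hv
    refine ⟨i, fun Z hi => Or.inl ?_⟩
    rintro x ⟨S, α, hF⟩
    exact (hF.edge_neg i j hij hl).1.1 hi
  · obtain rfl : false = b := hv
    refine ⟨i, fun Z hi => Or.inl ?_⟩
    rintro x ⟨S, α, hF⟩
    exact (hF.oneOrStar hl).1.1 hi
  · refine ⟨i, fun Z hi => Or.inr fun r hF => ?_⟩
    have hs : shade Z r i = 0 := if_pos hi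
    change decide (c = 0) = b at hv
    cases b
    · exact of_decide_eq_false hv ((hF.neg i c hl).symm.trans hs)
    · exact hF.pos i c hl (hs.trans (of_decide_eq_true hv).symm)

/-- A few auxiliary clauses are made harmless by taking few vertices away. -/
lemma exists_split_of_satisfies (cls : Fin ω → Fin B) {Δ : Finset (Clause (Var n ω ξ))}
    (h : ∀ C ∈ Δ, Satisfies emptyAssignment C) :
    ∃ (Z : Finset (Fin n)) (ΔA ΔB : Set (Clause (Var n ω ξ))), Z.card ≤ Δ.card ∧
      (Δ : Set (Clause (Var n ω ξ))) ⊆ ΔA ∪ ΔB ∧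
      pr {x : Sample n ω K B | ∃ C ∈ ΔA, CliqueFalsifies cls Z C x} ≤ 0 ∧
      pr {r : Fin n → Fin ξ | ∃ C ∈ ΔB, ColorFalsifies Z C r} ≤ 0 := by
  classical
  choose v hv using fun C : Δ => exists_vertex_of_satisfies (K := K) cls (h C.1 C.2)
  refine ⟨Finset.univ.image v, {C | ∀ x : Sample n ω K B, ¬ CliqueFalsifies cls (Finset.univ.image v) C x},
    {C | ∀ r, ¬ ColorFalsifies (Finset.univ.image v) C r}, ?_, ?_, ?_, ?_⟩
  · exact Finset.card_image_le.trans (by simp)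
  · exact fun C hC => hv ⟨C, hC⟩ _ (Finset.mem_image_of_mem _ (Finset.mem_univ _))
  · refine le_of_eq_of_le (congrArg pr (Set.eq_empty_of_forall_notMem ?_)) pr_empty.le
    rintro x ⟨C, hC, hF⟩
    exact hC x hF
  · refine le_of_eq_of_le (congrArg pr (Set.eq_empty_of_forall_notMem ?_)) pr_empty.le
    rintro r ⟨C, hC, hF⟩
    exact hC r hF

end FewClauses

/-! ### Counting small sets and classes -/

section Counting

variable {n ω K B : ℕ}

lemma card_smallSets_le (Z : Finset (Fin n)) (ℓ : ℕ) : (smallSets Z ℓ).card ≤ (n + 1) ^ ℓ := by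
  classical
  have hsub : smallSets Z ℓ ⊆ Finset.univ.image fun f : Fin ℓ → Option (Fin n) =>
      Finset.univ.filter fun i => ∃ k, f k = some i := by
    intro X hX
    have hc := (mem_smallSets.mp hX).1
    refine Finset.mem_image.mpr ⟨fun k => if h : k.1 < X.card then
      some (X.equivFin.symm ⟨k, h⟩).1 else none, Finset.mem_univ _, ?_⟩
    ext i
    simp only [Finset.mem_filter, Finset.mem_univ, true_and]
    constructor
    · rintro ⟨k, hk⟩
      split_ifs at hk
      rw [← Option.some.inj hk]
      exact Subtype.coe_prop _
    · intro hi
      have := (X.equivFin ⟨i, hi⟩).2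
      exact ⟨⟨X.equivFin ⟨i, hi⟩, by omega⟩, by simp⟩
  refine (Finset.card_le_card hsub).trans (Finset.card_image_le.trans ?_)
  simp

/-- The distribution of `[ω]` over `B` classes of almost the same size. -/
def residue [NeZero B] (u : Fin ω) : Fin B := Fin.ofNat B u.1

lemma card_residue_mul_le [NeZero ω] [NeZero B] (b : Fin B) :
    ((Finset.univ.filter fun u : Fin ω => residue u = b).card : ℝ) * B ≤ ω + B := by
  have hB := NeZero.pos B
  have hω := NeZero.pos ω
  have h : (Finset.univ.filter fun u : Fin ω => residue u = b).card ≤ (ω - 1) / B + 1 := by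
    rw [← Finset.card_range ((ω - 1) / B + 1)]
    refine Finset.card_le_card_of_injOn (fun u => u.1 / B) (fun u _ => ?_) fun u hu v hv huv => ?_
    · have : u.1 / B ≤ (ω - 1) / B := Nat.div_le_div_right (by omega)
      simp only [Finset.coe_range, Set.mem_Iio]
      omega
    · have h1 : u.1 % B = v.1 % B := by
        have := (Finset.mem_filter.mp hu).2.trans (Finset.mem_filter.mp hv).2.symm
        simpa [residue, Fin.ext_iff] using this
      have h2 : u.1 / B = v.1 / B := huv
      ext
      rw [← Nat.div_add_mod u.1 B, ← Nat.div_add_mod v.1 B, h1, h2]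
  have h2 := Nat.mul_le_mul_right B h
  have h3 := Nat.div_mul_le_self (ω - 1) B
  have h4 : (Finset.univ.filter fun u : Fin ω => residue u = b).card * B ≤ ω + B := by
    rw [add_mul] at h2
    omega
  exact_mod_cast h4

/-- The options of a member depend only on its class, so the union bound runs over `B` classes and
not over `ω` members. -/
lemma pr_exists_card_starVertices_lt [NeZero ω] [NeZero B] [NeZero K] (cls : Fin ω → Fin B)
    (Z : Finset (Fin n)) (t : ℕ) :
    pr {x : Sample n ω K B | ∃ u, (starVertices cls Z x u).card < t} ≤
      B * (2 ^ t * Real.exp (-((n - Z.card : ℝ) / (4 * K * B)))) := by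
  have hsub : {x : Sample n ω K B | ∃ u, (starVertices cls Z x u).card < t} ⊆
      ⋃ c ∈ (Finset.univ : Finset (Fin B)),
        {x | ∃ u, cls u = c ∧ (starVertices cls Z x u).card < t} := by
    rintro x ⟨u, hu⟩
    simp only [Set.mem_iUnion]
    exact ⟨cls u, Finset.mem_univ _, u, rfl, hu⟩
  refine (pr_mono hsub).trans ((pr_biUnion_le _ _).trans ?_)
  refine (Finset.sum_le_card_nsmul _ _ _ fun c _ => pr_card_starVertices_lt cls Z c t).trans ?_
  simp

end Counting

/-! ### Choice of the parameters -/

section Parameters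

variable {n ω ξ σ L μ M K B : ℕ}

lemma add_one_le_two_pow_half (hL : 6400 ≤ L) : L + 1 ≤ 2 ^ (L / 20 / 2) := by
  have h : ∀ m, 10 ≤ m → 40 * m + 40 ≤ 2 ^ m := by
    intro m hm
    induction m, hm using Nat.le_induction with
    | base => norm_num
    | succ m hm ih => rw [pow_succ]; omega
  have := h (L / 20 / 2) (by omega)
  omega

/-- With `K = σM` this yields `B ≥ 2`. Cubing both sides avoids fractional powers when using `σ ^ 3
≤ n`. -/
lemma mul_sq_le_of_pow_le (hM : 2 ^ 16 ≤ M) (hMn : M ^ 20 ≤ n) (hσ : σ ^ 3 ≤ n) :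
    2 ^ 24 * (σ * M) ^ 2 ≤ n := by
  refine le_of_pow_le_pow_left₀ (n := 3) (by norm_num) (Nat.zero_le _) ?_
  have h1 : 2 ^ 72 * M ^ 6 ≤ n := by
    refine le_trans ?_ hMn
    calc 2 ^ 72 * M ^ 6 ≤ (2 ^ 16) ^ 14 * M ^ 6 := Nat.mul_le_mul_right _ (by norm_num)
      _ ≤ M ^ 14 * M ^ 6 := Nat.mul_le_mul_right _ (Nat.pow_le_pow_left hM 14)
      _ = M ^ 20 := by ring
  calc (2 ^ 24 * (σ * M) ^ 2) ^ 3 = (2 ^ 72 * M ^ 6) * (σ ^ 3 * σ ^ 3) := by ring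
    _ ≤ n * (n * n) := Nat.mul_le_mul h1 (Nat.mul_le_mul hσ hσ)
    _ = n ^ 3 := by ring

lemma mul_cube_le_of_pow_le (hM : 2 ^ 16 ≤ M) (hMn : M ^ 20 ≤ n) (hσ : σ ^ 3 ≤ n)
    (hω : σ * ω ≤ n) : 2 ^ 57 * ω * (σ * M) ^ 3 ≤ n ^ 2 := by
  refine le_of_pow_le_pow_left₀ (n := 3) (by norm_num) (Nat.zero_le _) ?_
  have h1 : 2 ^ 171 * M ^ 9 ≤ n := by
    refine le_trans ?_ hMn
    calc 2 ^ 171 * M ^ 9 ≤ (2 ^ 16) ^ 11 * M ^ 9 := Nat.mul_le_mul_right _ (by norm_num)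
      _ ≤ M ^ 11 * M ^ 9 := Nat.mul_le_mul_right _ (Nat.pow_le_pow_left hM 11)
      _ = M ^ 20 := by ring
  calc (2 ^ 57 * ω * (σ * M) ^ 3) ^ 3
      = (2 ^ 171 * M ^ 9) * ((σ * ω) ^ 3 * (σ ^ 3 * σ ^ 3)) := by ring
    _ ≤ n * (n ^ 3 * (n * n)) := Nat.mul_le_mul h1
        (Nat.mul_le_mul (Nat.pow_le_pow_left hω 3) (Nat.mul_le_mul hσ hσ))
    _ = (n ^ 2) ^ 3 := by ring

lemma half_pow_le {e T : ℕ} (h : T ≤ 320 * e) :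
    (1 / 2 : ℝ) ^ e ≤ 1 / (2 : ℝ) ^ ((T : ℝ) / 320) := by
  rw [one_div_pow]
  refine one_div_le_one_div_of_le (by positivity) ?_
  rw [← Real.rpow_natCast]
  refine Real.rpow_le_rpow_of_exponent_le (by norm_num) ?_
  rw [div_le_iff₀ (by norm_num)]
  exact_mod_cast (by omega : T ≤ e * 320)

lemma exp_neg_le_half_pow (e : ℕ) : Real.exp (-(e : ℝ)) ≤ (1 / 2) ^ e := by
  rw [one_div_pow, Real.exp_neg, ← one_div]
  refine one_div_le_one_div_of_le (by positivity) ?_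
  rw [← mul_one (e : ℝ), Real.exp_nat_mul]
  exact pow_le_pow_left₀ (by norm_num) (by have := Real.add_one_le_exp (1 : ℝ); linarith) e

lemma two_pow_le_exp (e : ℕ) : (2 : ℝ) ^ e ≤ Real.exp e := by
  rw [← mul_one (e : ℝ), Real.exp_nat_mul]
  exact pow_le_pow_left₀ (by norm_num) (by have := Real.add_one_le_exp (1 : ℝ); linarith) e

/-- The probability that a fixed class has few vertices. -/
lemma class_error_le {z D : ℕ} (hB : 0 < B) (hK : 0 < K) (hBn : B * (2 ^ 23 * K ^ 2) ≤ n)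
    (hz : 2 * z ≤ n) (hD : D = 2 ^ 15 * K) (hnL : n < 2 ^ (L + 1)) (hLK : L + 1 ≤ K) :
    B * (2 ^ (8 * D) * Real.exp (-((n - z : ℝ) / (4 * K * B)))) ≤ 1 / 8 := by
  have hB' : (0 : ℝ) < B := by exact_mod_cast hB
  have hK' : (0 : ℝ) < K := by exact_mod_cast hK
  -- This explains the constant in `B`: `2^23 = 2 · 4 · 32 · 2^15`, for the half of the vertices
  -- that remain, the `4KB`, the `32D`, and `D = 2^15 K`.
  have h1 : (32 * D : ℝ) ≤ (n - z : ℝ) / (4 * K * B) := by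
    rw [le_div_iff₀ (by positivity), hD]
    have h2 : ((B * (2 ^ 23 * K ^ 2) : ℕ) : ℝ) ≤ n := by exact_mod_cast hBn
    have h3 : ((2 * z : ℕ) : ℝ) ≤ n := by exact_mod_cast hz
    push_cast at h2 h3 ⊢
    nlinarith
  have hB2 : (B : ℝ) ≤ Real.exp D := by
    refine le_trans ?_ (two_pow_le_exp D)
    have : B ≤ 2 ^ D := by
      calc B ≤ B * (2 ^ 23 * K ^ 2) := Nat.le_mul_of_pos_right _ (by positivity)
        _ ≤ 2 ^ (L + 1) := hBn.trans hnL.le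
        _ ≤ 2 ^ D := Nat.pow_le_pow_right (by norm_num) (by omega)
    exact_mod_cast this
  calc (B : ℝ) * (2 ^ (8 * D) * Real.exp (-((n - z : ℝ) / (4 * K * B))))
      ≤ Real.exp D * (Real.exp (8 * D : ℕ) * Real.exp (-(32 * D))) := by
        gcongr
        exact two_pow_le_exp _
    _ = Real.exp (-((23 * D : ℕ) : ℝ)) := by
        rw [← Real.exp_add, ← Real.exp_add]; congr 1; push_cast; ring
    _ ≤ (1 / 2) ^ (23 * D) := exp_neg_le_half_pow _
    _ ≤ (1 / 2) ^ 3 := pow_le_pow_of_le_one (by norm_num) (by norm_num) (by omega)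
    _ = 1 / 8 := by norm_num

/-- The base is `(L + 1)/M ≤ 2^{-m}` with `m ≥ L/80`, and the exponent is at least `σ/4`. -/
lemma div_pow_le_half_pow {m : ℕ} (hσ : 1 ≤ σ) (hM : 0 < M) (hLM : (L + 1) * 2 ^ m ≤ M)
    (hLm : L ≤ 80 * m) :
    ((σ * (L + 1) : ℕ) / (σ * M : ℕ) : ℝ) ^ (max 1 (σ / 2) / 2 + 1) ≤
      1 / (2 : ℝ) ^ (((σ * L : ℕ) : ℝ) / 320) := by
  have hbase : ((σ * (L + 1) : ℕ) / (σ * M : ℕ) : ℝ) ≤ (1 / 2) ^ m := by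
    have hpos : (0 : ℝ) < (σ * M : ℕ) := by exact_mod_cast Nat.mul_pos hσ hM
    rw [one_div_pow, div_le_div_iff₀ hpos (by positivity), one_mul]
    have h := Nat.mul_le_mul_left σ hLM
    rw [← mul_assoc] at h
    exact_mod_cast h
  refine (pow_le_pow_left₀ (by positivity) hbase _).trans ?_
  rw [← pow_mul]
  refine half_pow_le ?_
  have h : σ ≤ 4 * (max 1 (σ / 2) / 2 + 1) := by
    have := le_max_right 1 (σ / 2)
    omega
  calc σ * L ≤ 4 * (max 1 (σ / 2) / 2 + 1) * (80 * m) := Nat.mul_le_mul h hLm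
    _ = 320 * (m * (max 1 (σ / 2) / 2 + 1)) := by ring

/-- Here the logarithm in the hypothesis on `√ξ ω` is needed; the other estimates only use `σω ≤ n`.
-/
lemma exp_neg_excluded_le {D : ℕ} (hD : D = 2 ^ 15 * K) (hσK : σ * L ≤ K) (hB : 0 < B)
    (hnB : n ≤ 2 ^ 24 * K ^ 2 * B) (hmain : σ * ω * L ≤ 8 * n) :
    Real.exp (-(B / (2 * (ω + B)) * (4 * D ^ 2 : ℕ))) ≤
      1 / (2 : ℝ) ^ (((σ * L : ℕ) : ℝ) / 320) := by
  have hB0 : (0 : ℝ) < B := by exact_mod_cast hB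
  have hle : ((4 * (σ * L) : ℕ) : ℝ) ≤ B / (2 * (ω + B)) * (4 * D ^ 2 : ℕ) := by
    rw [div_mul_eq_mul_div, le_div_iff₀ (by positivity)]
    have h1 : 4 * (σ * L) * ω ≤ B * D ^ 2 := by
      calc 4 * (σ * L) * ω = 4 * (σ * ω * L) := by ring
        _ ≤ 4 * (8 * (2 ^ 24 * K ^ 2 * B)) := by omega
        _ = 2 ^ 29 * (B * K ^ 2) := by ring
        _ ≤ 2 ^ 30 * (B * K ^ 2) := Nat.mul_le_mul_right _ (by norm_num)
        _ = B * D ^ 2 := by rw [hD]; ring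
    have h2 : 4 * (σ * L) ≤ D ^ 2 := by
      calc 4 * (σ * L) ≤ D := by omega
        _ ≤ D ^ 2 := Nat.le_self_pow (by norm_num) D
    have h3 : 4 * (σ * L) * (2 * (ω + B)) ≤ B * (4 * D ^ 2) := by
      calc 4 * (σ * L) * (2 * (ω + B)) = 2 * (4 * (σ * L) * ω) + 2 * B * (4 * (σ * L)) := by ring
        _ ≤ 2 * (B * D ^ 2) + 2 * B * D ^ 2 := by gcongr
        _ = B * (4 * D ^ 2) := by ring
    exact_mod_cast h3
  refine (Real.exp_le_exp.mpr (neg_le_neg hle)).trans ?_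
  exact (exp_neg_le_half_pow _).trans (half_pow_le (by omega))

lemma sq_one_add_div_le (hB : 0 < B) (hω : 0 < ω) (hK : 512 ≤ K)
    (hnB : n ≤ 2 ^ 24 * K ^ 2 * B) (hn : 2 ^ 57 * ω * K ^ 3 ≤ n ^ 2) :
    128 * (1 + ω / B : ℝ) ^ 2 ≤ ω * K := by
  have hB0 : (0 : ℝ) < B := by exact_mod_cast hB
  have h1 : 512 * ω ≤ K * B ^ 2 := by
    have hK0 : 0 < K := by omega
    refine le_of_mul_le_mul_left (a := 2 ^ 48 * K ^ 3) ?_ (by positivity)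
    calc 2 ^ 48 * K ^ 3 * (512 * ω) = 2 ^ 57 * ω * K ^ 3 := by ring
      _ ≤ (2 ^ 24 * K ^ 2 * B) ^ 2 := hn.trans (Nat.pow_le_pow_left hnB 2)
      _ = _ := by ring
  have h1' : (512 * ω : ℝ) ≤ K * B ^ 2 := by exact_mod_cast h1
  have h2' : (512 : ℝ) ≤ ω * K := by
    exact_mod_cast hK.trans (Nat.le_mul_of_pos_left _ hω)
  have h3 : 512 * (ω / B : ℝ) ^ 2 ≤ ω * K := by
    rw [div_pow, mul_div_assoc', div_le_iff₀ (by positivity)]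
    have : (0 : ℝ) ≤ ω := Nat.cast_nonneg _
    nlinarith
  nlinarith [sq_nonneg (1 - ω / B : ℝ)]

/-- There are at most `(n + 1) ^ ℓ ≤ 2 ^ P` small sets, and half of the exponent in `4 ^ P` pays for
them. -/
lemma pow_mul_quarter_pow_le (hσ : 1 ≤ σ) (hnL : n < 2 ^ (L + 1)) :
    ((n + 1) ^ (max 1 (σ / 2)) : ℝ) * (1 / 4) ^ (σ * (L + 1)) ≤
      1 / (2 : ℝ) ^ (((σ * L : ℕ) : ℝ) / 320) := by
  have hle : ((n + 1) ^ (max 1 (σ / 2)) : ℝ) ≤ 2 ^ (σ * (L + 1)) := by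
    have : (n + 1) ^ (max 1 (σ / 2)) ≤ 2 ^ (σ * (L + 1)) := by
      calc (n + 1) ^ (max 1 (σ / 2)) ≤ (2 ^ (L + 1)) ^ (max 1 (σ / 2)) :=
            Nat.pow_le_pow_left (by omega) _
        _ ≤ (2 ^ (L + 1)) ^ σ := Nat.pow_le_pow_right (by positivity) (by omega)
        _ = _ := by rw [← pow_mul, mul_comm]
    exact_mod_cast this
  calc ((n + 1) ^ (max 1 (σ / 2)) : ℝ) * (1 / 4) ^ (σ * (L + 1))
      ≤ 2 ^ (σ * (L + 1)) * (1 / 4) ^ (σ * (L + 1)) := by gcongr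
    _ = (1 / 2) ^ (σ * (L + 1)) := by rw [← mul_pow]; norm_num
    _ ≤ _ := half_pow_le (by nlinarith)

/-- Parameters for which the approximation is good. -/
lemma exists_parameters {N : ℝ} (hL : 6400 ≤ L) (hLn : 2 ^ L ≤ n) (hnL : n < 2 ^ (L + 1))
    (hσ : 1 ≤ σ) (hσξ : σ ^ 2 ≤ ξ) (hξω : ξ < ω) (hmain : σ * ω * L ≤ 8 * n) (hN0 : 0 < N)
    (hN : 24 * N ≤ (2 : ℝ) ^ (((σ * L : ℕ) : ℝ) / 320)) :
    ∃ K B P ℓ D : ℕ, 0 < K ∧ 0 < B ∧ 2 ≤ P ∧ 2 * P ≤ K ∧ 4 * (ℓ * (ℓ - 1)) ≤ ξ ∧ 1 ≤ D ∧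
      4 * (P / K : ℝ) ^ (ℓ / 2 + 1) + (1 / B) ^ D +
        Real.exp (-(B / (2 * (ω + B)) * (4 * D ^ 2 : ℕ))) ≤ 1 / (2 * N) ∧
      ((n + 1) ^ ℓ : ℝ) * (1 / 4) ^ P ≤ 1 / (2 * N) ∧
      (∀ z : ℕ, 2 * z ≤ n →
        B * (2 ^ (8 * D) * Real.exp (-((n - z : ℝ) / (4 * K * B)))) ≤ 1 / 8) ∧
      128 * (1 + ω / B : ℝ) ^ 2 ≤ ω * K := by
  -- With `σ` about `√ξ` and `L` about `log n`, `M` is about `n^{1/20}`, the core has density `1/K`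
  -- with `K = σM`, and `B` is as large as the required number of options allows. Further, `ℓ` is
  -- about `σ/2`, so that small sets are mostly rainbow, and `P = σ(L + 1)`.
  obtain ⟨M, hM⟩ : ∃ M, M = 2 ^ (L / 20) := ⟨_, rfl⟩
  obtain ⟨m, hm⟩ : ∃ m, m = L / 20 / 2 := ⟨_, rfl⟩
  obtain ⟨K, hK⟩ : ∃ K, K = σ * M := ⟨_, rfl⟩
  obtain ⟨B, hB⟩ : ∃ B, B = n / (2 ^ 23 * K ^ 2) := ⟨_, rfl⟩
  obtain ⟨D, hD⟩ : ∃ D, D = 2 ^ 15 * K := ⟨_, rfl⟩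
  have hLm : L + 1 ≤ 2 ^ m := hm ▸ add_one_le_two_pow_half hL
  have hmM : 2 ^ m * 2 ^ m ≤ M := by
    rw [hM, ← pow_add]; exact Nat.pow_le_pow_right (by norm_num) (by omega)
  have h2m : 2 ^ 16 ≤ 2 ^ m := Nat.pow_le_pow_right (by norm_num) (by omega)
  have hM16 : 2 ^ 16 ≤ M := h2m.trans ((Nat.le_mul_of_pos_left _ (by positivity)).trans hmM)
  have hM20 : M ^ 20 ≤ n := by
    rw [hM, ← pow_mul]
    exact (Nat.pow_le_pow_right (by norm_num) (by omega)).trans hLn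
  have hLM : (L + 1) * 2 ^ m ≤ M := (Nat.mul_le_mul_right _ hLm).trans hmM
  have hLM' : L + 1 ≤ M := (Nat.le_mul_of_pos_right _ (by positivity)).trans hLM
  clear hM
  have hσω : σ * ω ≤ n := by
    have : σ * ω * 8 ≤ σ * ω * L := Nat.mul_le_mul_left _ (by omega)
    omega
  have hσ3 : σ ^ 3 ≤ n := by
    refine le_trans ?_ hσω
    rw [pow_succ, mul_comm]
    exact Nat.mul_le_mul_left _ (hσξ.trans hξω.le)
  have hn24 : 2 ^ 24 * K ^ 2 ≤ n := hK ▸ mul_sq_le_of_pow_le hM16 hM20 hσ3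
  have hn57 : 2 ^ 57 * ω * K ^ 3 ≤ n ^ 2 := hK ▸ mul_cube_le_of_pow_le hM16 hM20 hσ3 hσω
  have hKM : M ≤ K := hK ▸ Nat.le_mul_of_pos_left _ hσ
  have hK16 : 2 ^ 16 ≤ K := hM16.trans hKM
  have hK0 : 0 < K := lt_of_lt_of_le (by norm_num) hK16
  have hσK : σ * (L + 1) ≤ K := hK ▸ Nat.mul_le_mul_left σ hLM'
  have hKD : K ≤ D := hD ▸ Nat.le_mul_of_pos_left _ (by norm_num)
  have hB2 : 2 ≤ B := by
    rw [hB, Nat.le_div_iff_mul_le (by positivity), ← mul_assoc]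
    exact hn24
  have hBn : B * (2 ^ 23 * K ^ 2) ≤ n := hB ▸ Nat.div_mul_le_self _ _
  have hnB : n ≤ 2 ^ 24 * K ^ 2 * B := by
    have h1 : n < (B + 1) * (2 ^ 23 * K ^ 2) := by
      rw [mul_comm, hB]; exact Nat.lt_mul_div_succ n (by positivity)
    calc n ≤ (B + 1) * (2 ^ 23 * K ^ 2) := h1.le
      _ ≤ (2 * B) * (2 ^ 23 * K ^ 2) := Nat.mul_le_mul_right _ (by omega)
      _ = 2 ^ 24 * K ^ 2 * B := by ring
  have hNy : 1 / (2 : ℝ) ^ (((σ * L : ℕ) : ℝ) / 320) ≤ 1 / (2 * N) / 12 := by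
    refine (one_div_le_one_div_of_le (by positivity) hN).trans_eq ?_
    field_simp; norm_num
  have hN1 : 0 < 1 / (2 * N) := by positivity
  refine ⟨K, B, σ * (L + 1), max 1 (σ / 2), D, hK0, by omega, ?_, ?_, ?_, by omega, ?_, ?_, ?_, ?_⟩
  · exact (by omega : 2 ≤ L + 1).trans (Nat.le_mul_of_pos_left _ hσ)
  · rw [hK, mul_left_comm]
    refine Nat.mul_le_mul_left σ (le_trans ?_ hLM)
    rw [mul_comm]
    exact Nat.mul_le_mul_left _ ((by norm_num : 2 ≤ 2 ^ 16).trans h2m)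
  · rcases le_total (σ / 2) 1 with h | h
    · rw [max_eq_left h]; omega
    · rw [max_eq_right h]
      refine le_trans ?_ hσξ
      calc 4 * (σ / 2 * (σ / 2 - 1)) ≤ 4 * (σ / 2 * (σ / 2)) := by gcongr; omega
        _ = (2 * (σ / 2)) ^ 2 := by ring
        _ ≤ σ ^ 2 := Nat.pow_le_pow_left (by omega) 2
  · have e1 := (div_pow_le_half_pow hσ (lt_of_lt_of_le (by norm_num) hM16) hLM
      (by omega)).trans hNy
    rw [← hK] at e1
    have e2 : (1 / B : ℝ) ^ D ≤ 1 / (2 * N) / 12 := by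
      have hB2' : (2 : ℝ) ≤ B := by exact_mod_cast hB2
      refine (pow_le_pow_left₀ (by positivity)
        (one_div_le_one_div_of_le (by norm_num) hB2') D).trans ((half_pow_le ?_).trans hNy)
      rw [mul_add] at hσK
      omega
    have e3 := (exp_neg_excluded_le hD (by rw [mul_add] at hσK; omega) (by omega) hnB
      hmain).trans hNy
    linarith only [e1, e2, e3, hN1]
  · refine ((pow_mul_quarter_pow_le hσ hnL).trans hNy).trans ?_
    linarith only [hN1]
  · intro z hz
    exact class_error_le (by omega) hK0 hBn hz hD hnL (hLM'.trans hKM)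
  · exact sq_one_add_div_le (by omega) (by omega) (by omega) hnB hn57

end Parameters

/-! ### Assembling the lower bound -/

section LowerBound

lemma IsRefutation.mono {V : Type*} [DecidableEq V] {Ψ Ψ' : Set (Clause V)} {π : List (Clause V)}
    (h : IsRefutation Ψ π) (hΨ : ∀ C ∈ π, C ∈ Ψ → C ∈ Ψ') : IsRefutation Ψ' π :=
  ⟨fun i => (h.1 i).imp_left (hΨ _ (List.get_mem π i)), h.2⟩

/-- Only the auxiliary clauses that occur in the refutation matter. -/
def RandomRefutation.trim {V : Type*} [DecidableEq V] {Ψ : Set (Clause V)} {δ : ℝ} {S : Type*}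
    (R : RandomRefutation Ψ δ S) : RandomRefutation Ψ δ S where
  prob := R.prob
  refutation := R.refutation
  aux s := (R.aux s).filter (· ∈ R.refutation s)
  isRefutation s := (R.isRefutation s).mono fun C hC h => h.imp_right fun h => by simp_all
  satisfied a := (R.satisfied a).trans (R.prob.toOuterMeasure.mono fun s hs C hC =>
    hs C (Finset.mem_filter.mp hC).1)

lemma RandomRefutation.card_aux_trim_le {V : Type*} [DecidableEq V] {Ψ : Set (Clause V)} {δ : ℝ}
    {S : Type*} (R : RandomRefutation Ψ δ S) (s : S) :
    (R.trim.aux s).card ≤ (R.refutation s).length := by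
  refine (Finset.card_le_card fun C hC => ?_).trans (List.toFinset_card_le (R.refutation s))
  exact List.mem_toFinset.mpr (Finset.mem_filter.mp hC).2

variable {n ω ξ L σ : ℕ}

/-- A random refutation whose auxiliary clauses are few, compared with the probability that they
fail, is long. -/
theorem RandomRefutation.exists_le_length {N δ : ℝ} {S : Type*}
    (R : RandomRefutation (cliqueClauses n ω ξ ∪ colorClauses n ω ξ) δ S) (hδ : δ < 1) {d : ℕ}
    (hd : ∀ s, (R.aux s).card ≤ d) (hdδ : d * √δ ≤ 1)
    (hL : 6400 ≤ L) (hLn : 2 ^ L ≤ n) (hnL : n < 2 ^ (L + 1))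
    (hσ : 1 ≤ σ) (hσξ : σ ^ 2 ≤ ξ) (hξω : ξ < ω) (hmain : σ * ω * L ≤ 8 * n) (hN0 : 0 < N)
    (hN : 24 * N ≤ (2 : ℝ) ^ (((σ * L : ℕ) : ℝ) / 320)) :
    ∃ s, N ≤ (R.refutation s).length := by
  obtain ⟨K, B, P, ℓ, D, hK, hB, hP, hPK, hℓ, hD, heU, heV, hstar, hx⟩ :=
    exists_parameters hL hLn hnL hσ hσξ hξω hmain hN0 hN
  have hξ0 : 0 < ξ := lt_of_lt_of_le (Nat.pow_pos hσ) hσξ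
  have : NeZero K := ⟨hK.ne'⟩
  have : NeZero B := ⟨hB.ne'⟩
  have : NeZero ω := ⟨by omega⟩
  have : NeZero ξ := ⟨hξ0.ne'⟩
  have hn64 : 64 ≤ n := (by norm_num : 64 = 2 ^ 6).le.trans
    ((Nat.pow_le_pow_right (by norm_num) (by omega)).trans hLn)
  obtain ⟨s, Z, ΔA, ΔB, hZ, hsub, hA, hBV⟩ : ∃ (s : S) (Z : Finset (Fin n))
      (ΔA ΔB : Set (Clause (Var n ω ξ))), 2 * Z.card ≤ n ∧
      (R.aux s : Set (Clause (Var n ω ξ))) ⊆ ΔA ∪ ΔB ∧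
      pr {x : Sample n ω K B | ∃ C ∈ ΔA, CliqueFalsifies residue Z C x} ≤ 1 / 8 ∧
      pr {r : Fin n → Fin ξ | ∃ C ∈ ΔB, ColorFalsifies Z C r} ≤ 1 / 4 := by
    rcases lt_or_ge d 32 with hd32 | hd32
    -- The splitting needs `d ≥ 32`. For smaller `d`, `δ < 1` provides a sample whose clauses all
    -- hold in one given assignment, and fewer than `32 ≤ n/2` vertices are removed.
    · obtain ⟨s, hs⟩ := R.exists_le_pr fun _ : Unit => emptyAssignment
      have hsat : ∀ C ∈ R.aux s, Satisfies emptyAssignment C := by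
        by_contra hcon
        have : {_w : Unit | ∀ C ∈ R.aux s, Satisfies emptyAssignment C} = ∅ :=
          Set.eq_empty_of_forall_notMem fun _ h => hcon h
        rw [this, pr_empty] at hs
        linarith
      obtain ⟨Z, ΔA, ΔB, hZ, hsub, hA, hB⟩ := exists_split_of_satisfies (K := K)
        (residue : Fin ω → Fin B) hsat
      have := hd s
      exact ⟨s, Z, ΔA, ΔB, by omega, hsub, hA.trans (by norm_num), hB.trans (by norm_num)⟩
    · obtain ⟨s, hs⟩ := R.exists_le_pr fun w : (Fin n → Fin ξ) × Sample n ω K B =>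
        assignment ∅ w.2 w.1
      have hd0 : (0 : ℝ) < d := by exact_mod_cast (by omega : 0 < d)
      have hδd : δ ≤ 1 / d ^ 2 := by
        rw [← le_div_iff₀' hd0] at hdδ
        rcases le_total δ 0 with h | h
        · exact h.trans (by positivity)
        · rw [← one_div_pow]
          exact Real.sqrt_le_left (by positivity) |>.mp hdδ
      have hfail : pr {w : (Fin n → Fin ξ) × Sample n ω K B |
          ¬ ∀ C ∈ R.aux s, Satisfies (assignment ∅ w.2 w.1) C} ≤ 1 / d ^ 2 := by
        have := pr_compl {w : (Fin n → Fin ξ) × Sample n ω K B |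
          ∀ C ∈ R.aux s, Satisfies (assignment ∅ w.2 w.1) C}
        refine (this.trans_le ?_).trans hδd
        linarith
      obtain ⟨ΔA, ΔB, hsub, hA, hB⟩ := exists_split (cls := residue) hd32 hx (hd s) hfail
      exact ⟨s, ∅, ΔA, ΔB, by simp, hsub, hA, hB⟩
  refine ⟨s, ?_⟩
  have hπ : IsRefutation (cliqueClauses n ω ξ ∪ colorClauses n ω ξ ∪ (ΔA ∪ ΔB))
      (R.refutation s) := (R.isRefutation s).mono fun C _ h => h.imp_right fun h => hsub h
  have heV' : (smallSets Z ℓ).card * (1 / 4 : ℝ) ^ P ≤ 1 / (2 * N) := by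
    refine le_trans ?_ heV
    gcongr
    exact_mod_cast card_smallSets_le Z ℓ
  have haS := (pr_exists_card_starVertices_lt (K := K) (residue : Fin ω → Fin B) Z (8 * D)).trans
    (hstar Z.card hZ)
  have h2N : ∀ t : ℝ, t * (1 / (2 * N)) = t / (2 * N) := fun t => mul_one_div t _
  -- The initial errors are at most `1/8 + 1/8` out of `1` on the clique side and `1/4` out of `3/4`
  -- on the color side. Either way at least `1/2` is left for the lines, each worth `1/(2N)`.
  rcases one_le_or_le_of_isRefutation card_residue_mul_le hP hPK hℓ hD hπ heU heV' hA haS hBV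
    with h | h
  · rw [h2N] at h
    have : 3 / 4 ≤ ((R.refutation s).length : ℝ) / (2 * N) := by linarith
    rw [le_div_iff₀ (by positivity)] at this
    linarith
  · rw [h2N] at h
    have : 1 / 2 ≤ ((R.refutation s).length : ℝ) / (2 * N) := by linarith
    rw [le_div_iff₀ (by positivity)] at this
    linarith

/-- There is no trivial random refutation. -/
lemma RandomRefutation.exists_two_le_length {δ : ℝ} {S : Type*} (hn : 0 < n) (hξ : 0 < ξ)
    (R : RandomRefutation (cliqueClauses n ω ξ ∪ colorClauses n ω ξ) δ S) (hδ : δ < 1) :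
    ∃ s, 2 ≤ (R.refutation s).length := by
  -- A refutation with a single line is the empty clause. It is no axiom, and as an auxiliary clause
  -- it is satisfied by no assignment; any fixed assignment gives a sample without it.
  obtain ⟨s, hs⟩ := R.exists_le_pr fun (_ : Unit) _ => false
  refine ⟨s, ?_⟩
  by_contra! hlen
  have hlast := (R.isRefutation s).2
  rw [List.getLast?_eq_some_iff] at hlast
  obtain ⟨ys, hys⟩ := hlast
  have hys0 : ys = [] := by
    rw [hys, List.length_append, List.length_singleton] at hlen
    exact List.eq_nil_of_length_eq_zero (by omega)
  rw [hys0, List.nil_append] at hys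
  have hmem := (R.isRefutation s).1
  rw [hys] at hmem
  rcases hmem ⟨0, by simp⟩ with h | ⟨j, -, hj, -⟩
  · simp only [List.get_eq_getElem, List.getElem_cons_zero] at h
    have : Nonempty (Fin n) := ⟨⟨0, hn⟩⟩
    have : Nonempty (Fin ξ) := ⟨⟨0, hξ⟩⟩
    rcases h with (h | h) | h
    · rcases h with ⟨u, h⟩ | ⟨u, v, i, -, h⟩ | ⟨u, v, i, j, hij, -, h⟩
      · exact (Finset.univ_nonempty.image _).ne_empty h.symm
      · exact Finset.insert_ne_empty _ _ h.symm
      · exact Finset.insert_ne_empty _ _ h.symm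
    · rcases h with ⟨u, h⟩ | ⟨u, v, i, -, h⟩ | ⟨u, i, j, hij, h⟩
      · exact (Finset.univ_nonempty.image _).ne_empty h.symm
      · exact Finset.insert_ne_empty _ _ h.symm
      · exact Finset.insert_ne_empty _ _ h.symm
    · have : {_w : Unit | ∀ C ∈ R.aux s, Satisfies (fun _ : Var n ω ξ => false) C} = ∅ :=
        Set.eq_empty_of_forall_notMem fun _ h' => by
          obtain ⟨l, hl, -⟩ := h' ∅ h
          simp at hl
      rw [this, pr_empty] at hs
      linarith
  · exact absurd hj (Nat.not_lt_zero _)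

lemma rpow_le_two {c : ℝ} {Q : ℕ} (hc : c = 1 / (Q : ℝ) ^ 2) (hn : 0 < n) (hnQ : n ≤ Q)
    (hξ : ξ ≤ n) : (n : ℝ) ^ (c * √(ξ : ℝ)) ≤ 2 := by
  have hn0 : (0 : ℝ) < n := by exact_mod_cast hn
  have hnQ' : (n : ℝ) ≤ Q := by exact_mod_cast hnQ
  have hQ0 : (0 : ℝ) < Q := hn0.trans_le hnQ'
  have hc0 : 0 ≤ c := by rw [hc]; positivity
  have hξn : √(ξ : ℝ) ≤ n := by
    refine Real.sqrt_le_iff.mpr ⟨hn0.le, ?_⟩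
    have h1 : ξ ≤ n ^ 2 := hξ.trans (Nat.le_self_pow (by norm_num) n)
    exact_mod_cast h1
  have h2n : (n : ℝ) ≤ 2 ^ (n : ℝ) := by
    rw [Real.rpow_natCast]
    exact_mod_cast (Nat.lt_two_pow_self).le
  calc (n : ℝ) ^ (c * √(ξ : ℝ)) ≤ (2 ^ (n : ℝ)) ^ (c * √(ξ : ℝ)) := by gcongr
    _ = 2 ^ (n * (c * √(ξ : ℝ))) := by rw [← Real.rpow_mul (by norm_num)]
    _ ≤ 2 ^ (1 : ℝ) := by
        refine Real.rpow_le_rpow_of_exponent_le (by norm_num) ?_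
        calc n * (c * √(ξ : ℝ)) ≤ Q * (c * Q) := by gcongr; exact hξn.trans hnQ'
          _ = 1 := by rw [hc]; field_simp
    _ = 2 := by norm_num

/-- The exponent `σL/320` is halved: one half dominates the power of `n`, since `√ξ ≤ 2σ` and `n ≤
2^{2L}`, and the other absorbs the factor `24`. -/
lemma rpow_le_two_rpow {c : ℝ} (hc0 : 0 ≤ c) (hc : c ≤ 1 / 2560) (hL : 6400 ≤ L)
    (hnL : n < 2 ^ (L + 1)) (hσ : 1 ≤ σ) (hξ : ξ < (σ + 1) ^ 2) :
    24 * (n : ℝ) ^ (c * √(ξ : ℝ)) ≤ (2 : ℝ) ^ (((σ * L : ℕ) : ℝ) / 320) := by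
  have hσ' : (1 : ℝ) ≤ σ := by exact_mod_cast hσ
  have hL' : (6400 : ℝ) ≤ L := by exact_mod_cast hL
  have hσL : (6400 : ℝ) ≤ σ * L := by nlinarith
  have hξσ : √(ξ : ℝ) ≤ 2 * σ := by
    refine Real.sqrt_le_iff.mpr ⟨by positivity, ?_⟩
    have : (ξ : ℝ) ≤ (σ + 1) ^ 2 := by exact_mod_cast hξ.le
    nlinarith
  have hn2 : (n : ℝ) ≤ 2 ^ (2 * L : ℝ) := by
    have : n ≤ 2 ^ (2 * L) := hnL.le.trans (Nat.pow_le_pow_right (by norm_num) (by omega))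
    have h : (n : ℝ) ≤ 2 ^ (2 * L) := by exact_mod_cast this
    refine h.trans_eq ?_
    rw [← Real.rpow_natCast]
    push_cast
    rfl
  have h1 : (n : ℝ) ^ (c * √(ξ : ℝ)) ≤ 2 ^ ((σ * L : ℝ) / 640) := by
    calc (n : ℝ) ^ (c * √(ξ : ℝ)) ≤ (2 ^ (2 * L : ℝ)) ^ (c * √(ξ : ℝ)) := by gcongr
      _ = 2 ^ (2 * L * (c * √(ξ : ℝ))) := by rw [← Real.rpow_mul (by norm_num)]
      _ ≤ 2 ^ ((σ * L : ℝ) / 640) := by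
          refine Real.rpow_le_rpow_of_exponent_le (by norm_num) ?_
          calc 2 * L * (c * √(ξ : ℝ)) ≤ 2 * L * (1 / 2560 * (2 * σ)) := by gcongr
            _ = (σ * L : ℝ) / 640 := by ring
  have h2 : (24 : ℝ) ≤ 2 ^ ((σ * L : ℝ) / 640) := by
    calc (24 : ℝ) ≤ 2 ^ ((5 : ℕ) : ℝ) := by rw [Real.rpow_natCast]; norm_num
      _ ≤ _ := Real.rpow_le_rpow_of_exponent_le (by norm_num) (by push_cast; linarith)
  calc 24 * (n : ℝ) ^ (c * √(ξ : ℝ)) ≤ 2 ^ ((σ * L : ℝ) / 640) * 2 ^ ((σ * L : ℝ) / 640) := by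
        gcongr
    _ = _ := by
        rw [← Real.rpow_add (by norm_num)]
        congr 1
        push_cast
        ring

lemma sqrt_mul_mul_log_le (hL : 1 ≤ Nat.log 2 n)
    (h : √(ξ : ℝ) * (ω : ℝ) ≤ 8 * (n : ℝ) / Real.logb 2 (n : ℝ)) :
    Nat.sqrt ξ * ω * Nat.log 2 n ≤ 8 * n := by
  have hlog : (Nat.log 2 n : ℝ) ≤ Real.logb 2 n := by
    exact_mod_cast Real.natLog_le_logb n 2
  have hL' : (1 : ℝ) ≤ Nat.log 2 n := by exact_mod_cast hL
  rw [le_div_iff₀ (by linarith)] at h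
  have hσ : (Nat.sqrt ξ : ℝ) ≤ √(ξ : ℝ) := Real.nat_sqrt_le_real_sqrt
  have : (Nat.sqrt ξ : ℝ) * ω * Nat.log 2 n ≤ 8 * n := by
    refine le_trans ?_ h
    gcongr
  exact_mod_cast this

/-- The lower bound on the number of clauses, for few auxiliary clauses. -/
theorem exists_const_rpow_le_length : ∃ c : ℝ, 0 < c ∧ ∀ n ω ξ : ℕ, ω ≤ n → ξ < ω → 1 ≤ ξ →
    √(ξ : ℝ) * (ω : ℝ) ≤ 8 * (n : ℝ) / Real.logb 2 (n : ℝ) → ∀ δ : ℝ, δ < 1 →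
    ∀ (S : Type*) (R : RandomRefutation (cliqueClauses n ω ξ ∪ colorClauses n ω ξ) δ S) (d : ℕ),
      (∀ s, (R.aux s).card ≤ d) → d * √δ ≤ 1 →
      ∃ s, (n : ℝ) ^ (c * √(ξ : ℝ)) ≤ (R.refutation s).length := by
  obtain ⟨e, he⟩ : ∃ e : ℕ, e = 6400 := ⟨_, rfl⟩
  obtain ⟨Q, hQ⟩ : ∃ Q : ℕ, Q = 2 ^ e := ⟨_, rfl⟩
  have hQ12 : 2 ^ 12 ≤ Q := hQ ▸ Nat.pow_le_pow_right (by norm_num) (by omega)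
  have hQ' : (2560 : ℝ) ≤ Q := by exact_mod_cast (by norm_num : 2560 ≤ 2 ^ 12).trans hQ12
  -- This constant serves both regimes: for `n ≤ Q` it makes the bound at most `2`, the trivial
  -- length, and it is below the `1/2560` needed for large `n`.
  refine ⟨1 / (Q : ℝ) ^ 2, by positivity, fun n ω ξ hωn hξω hξ hmain δ hδ S R d hd hdδ => ?_⟩
  have hn : 0 < n := by omega
  rcases lt_or_ge (Nat.log 2 n) 6400 with hL | hL
  · have hnQ : n ≤ Q := hQ ▸ (Nat.lt_pow_of_log_lt (by norm_num) (he ▸ hL)).le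
    obtain ⟨s, hs⟩ := R.exists_two_le_length hn hξ hδ
    exact ⟨s, (rpow_le_two rfl hn hnQ (by omega)).trans (by exact_mod_cast hs)⟩
  · refine R.exists_le_length hδ hd hdδ hL (Nat.pow_log_le_self 2 hn.ne')
      (Nat.lt_pow_succ_log_self (by norm_num) n) (Nat.sqrt_pos.mpr hξ) (Nat.sqrt_le' ξ) hξω
      (sqrt_mul_mul_log_le (by omega) hmain) (by positivity) ?_
    refine rpow_le_two_rpow (by positivity) ?_ hL (Nat.lt_pow_succ_log_self (by norm_num) n)
      (Nat.sqrt_pos.mpr hξ) (Nat.lt_succ_sqrt' ξ)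
    exact one_div_le_one_div_of_le (by norm_num) (by nlinarith)

end LowerBound

end RandRes

theorem theorem1 :
    ∃ c : ℝ, 0 < c ∧
      ∀ n ω ξ : ℕ, ω ≤ n → ξ < ω → 1 ≤ ξ →
        √(ξ : ℝ) * (ω : ℝ) ≤ 8 * (n : ℝ) / Real.logb 2 (n : ℝ) →
        ∀ δ : ℝ, δ < 1 →
        ∀ (S : Type*)
          (R : RandRes.RandomRefutation
            (RandRes.cliqueClauses n ω ξ ∪ RandRes.colorClauses n ω ξ) δ S)
          (k d : ℕ), R.HasNumClauses k → R.HasMaxAux d →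
          ((d : ℝ) * δ < 1 →
            (1 - (d : ℝ) * √δ) * (n : ℝ) ^ (c * √(ξ : ℝ)) ≤ (k : ℝ)) ∧
          min (1 / ENNReal.ofReal (2 * √δ)) (ENNReal.ofReal ((n : ℝ) ^ (c * √(ξ : ℝ))))
            ≤ (k : ℝ≥0∞) := by
  obtain ⟨c, hc, hmain⟩ := RandRes.exists_const_rpow_le_length
  refine ⟨c, hc, fun n ω ξ hωn hξω hξ hlog δ hδ S R k d hk hd => ⟨fun _ => ?_, ?_⟩⟩
  · have hN : 0 ≤ (n : ℝ) ^ (c * √(ξ : ℝ)) := by positivity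
    have hk0 : (0 : ℝ) ≤ k := Nat.cast_nonneg k
    have hd0 : 0 ≤ (d : ℝ) * √δ := by positivity
    -- If the factor `1 - d√δ` is nonnegative, the bound even holds without it; otherwise the left
    -- side is not positive.
    rcases le_total ((d : ℝ) * √δ) 1 with h | h
    · obtain ⟨s, hs⟩ := hmain n ω ξ hωn hξω hξ hlog δ hδ S R d (fun s => hd.2 ⟨s, rfl⟩) h
      have hsk : ((R.refutation s).length : ℝ) ≤ k := by exact_mod_cast hk.2 ⟨s, rfl⟩
      nlinarith
    · nlinarith
  · rcases le_total (1 : ℝ) (k * (2 * √δ)) with h | h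
    · refine (min_le_left _ _).trans ?_
      rw [ENNReal.div_le_iff_le_mul (Or.inr (by simp)) (Or.inl ENNReal.ofReal_ne_top),
        ← ENNReal.ofReal_natCast, ← ENNReal.ofReal_mul (Nat.cast_nonneg k),
        ← ENNReal.ofReal_one]
      exact ENNReal.ofReal_le_ofReal h
    · refine (min_le_right _ _).trans ?_
      have hδ0 : 0 ≤ (k : ℝ) * √δ := by positivity
      -- After discarding the auxiliary clauses that a refutation does not use, at most `k` remain,
      -- so `k` can play the role of `d`.
      obtain ⟨s, hs⟩ := hmain n ω ξ hωn hξω hξ hlog δ hδ S R.trim k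
        (fun s => (R.card_aux_trim_le s).trans (hk.2 ⟨s, rfl⟩)) (by linarith)
      rw [← ENNReal.ofReal_natCast]
      refine ENNReal.ofReal_le_ofReal (hs.trans ?_)
      exact_mod_cast hk.2 ⟨s, rfl⟩
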